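/- Let $(\mathbb A,\mathcal G)$ be a measurable space. For measures $\mu,\nu$ on a measurable space (not necessarily finite or $\sigma$-finite) let the information divergence be $$D(\mu\Vert\nu)=\sup\sum_{i} f\!\left(\frac{\mu(A_i)}{\nu(A_i)}\right)\nu(A_i)\in[0,\infty],\qquad f(x)=x\ln x-(x-1),$$ where the supremum is over all partitions of the space into finitely many measurable sets $A_1,\dots,A_n$ (equivalently, over all finite sub-$\sigma$-algebras), with the conventions $f(0/0)\cdot 0=f(\infty/\infty)\cdot\infty=0$ and $f(\infty)\cdot 0=\infty$. For a set $C$ of measures put $D(C\Vert\nu)=\inf_{\mu\in C}D(\mu\Vert\nu)$, and say that $\nu^*$ is the information projection of $\nu$ on $C$ if $$D(\mu\Vert\nu)\ \ge\ D(\mu\Vert\nu^*)+D(C\Vert\nu)\qquad\text{for all }\mu\in C .$$ An empirical measure on $\mathbb A$ is a measure $\eta$ with $\eta(A)\in\{0,1,2,\dots\}\cup\{\infty\}$ for all $A\in\mathcal G$. The set of empirical measures carries the $\sigma$-algebra generated by the maps $\eta\mapsto\eta(A)$, $A\in\mathcal G$. A point process on $\mathbb A$, identified with its law, is a probability measure $P$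 on this space; its expectation measure is $\int\eta\,\mathrm dP(\eta)$. The Poisson point process $Po(\nu)$ with expectation measure $\nu$ is the point process such that $\eta(A)$ is Poisson distributed with mean $\nu(A)$ for every $A\in\mathcal G$ (almost surely equal to $\infty$ if $\nu(A)=\infty$), and $\eta(A_1),\dots,\eta(A_n)$ are independent for all pairwise disjoint $A_1,\dots,A_n\in\mathcal G$. **Theorem.** Let $C$ be a convex set of measures on $\mathbb A$, and let $\tilde C$ be the set of point processes on $\mathbb A$ whose expectation measure belongs to $C$. Let $\nu$ and $\nu^*$ be measures on $\mathbb A$ for which the Poisson point processes $Po(\nu)$ and $Po(\nu^*)$ exist. If $\nu^*$ is the information projection of $\nu$ on $C$, then $Po(\nu^*)$ is the information projection of $Po(\nu)$ on $\tilde C$, that is, $$D(P\Vert Po(\nu))\ \ge\ D(P\Vert Po(\nu^*))+D(\tilde C\Vert Po(\nu))\qquad\text{for all }P\in\tilde C .$$ -/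

import Mathlib

open MeasureTheory ProbabilityTheory
open scoped ENNReal NNReal

noncomputable section

/-- The function `f(x) = x ln x - (x - 1)` on `[0, ∞]`, with `f(∞) = ∞`. -/
def divFun (x : ℝ≥0∞) : ℝ≥0∞ :=
  if x = ∞ then ∞ else ENNReal.ofReal (x.toReal * Real.log x.toReal - (x.toReal - 1))

/-- The summand `f(x / y) · y` of the information divergence, with the conventions
`f(0/0) · 0 = 0`, `f(∞/∞) · ∞ = 0` and `f(x/0) · 0 = f(∞) · 0 = ∞` for `x ≠ 0`.
(In all other cases the arithmetic of `[0, ∞]` gives the intended value.) -/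
def divTerm (x y : ℝ≥0∞) : ℝ≥0∞ :=
  if x = ∞ ∧ y = ∞ then 0
  else if x ≠ 0 ∧ y = 0 then ∞
  else divFun (x / y) * y

/-- Information divergence `D(μ‖ν)` of two arbitrary measures: the supremum of the discrete
divergences of the restrictions to finite sub-`σ`-algebras. A finite sub-`σ`-algebra is given by its
atoms, i.e. by a measurable partition of the space into finitely many cells, and this is
encoded by a measurable map `g` to a finite set, the cells being the fibres of `g`
(an empty fibre contributes `0`). -/
def infoDiv {X : Type*} [MeasurableSpace X] (μ ν : Measure X) : ℝ≥0∞ :=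
  ⨆ (n : ℕ) (g : X → Fin n) (_ : Measurable g),
    ∑ i, divTerm (μ (g ⁻¹' {i})) (ν (g ⁻¹' {i}))

/-- `D(C‖ν) = inf_{μ ∈ C} D(μ‖ν)`. -/
def infoDivSet {X : Type*} [MeasurableSpace X] (C : Set (Measure X)) (ν : Measure X) : ℝ≥0∞ :=
  ⨅ μ ∈ C, infoDiv μ ν

/-- `νs` is the information projection of `ν` on `C`:
`D(μ‖ν) ≥ D(μ‖νs) + D(C‖ν)` for all `μ ∈ C`. -/
def IsInfoProjection {X : Type*} [MeasurableSpace X]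
    (C : Set (Measure X)) (ν νs : Measure X) : Prop :=
  ∀ μ ∈ C, infoDiv μ νs + infoDivSet C ν ≤ infoDiv μ ν

/-- Empirical measures: all values are natural numbers or `∞`. The subtype carries the
`σ`-algebra generated by the evaluations `η ↦ η A`, `A` measurable. -/
abbrev EmpiricalMeasure (𝔸 : Type*) [MeasurableSpace 𝔸] : Type _ :=
  {η : Measure 𝔸 // ∀ A, MeasurableSet A → ∃ k : ℕ∞, η A = (k : ℝ≥0∞)}

/-- The expectation measure of a point process with law `P`: the mixture `∫ η dP(η)`. -/
def expectationMeasure {𝔸 : Type*} [MeasurableSpace 𝔸] (P : Measure (EmpiricalMeasure 𝔸)) :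
    Measure 𝔸 :=
  P.bind (fun η => (η : Measure 𝔸))

/-- The (laws of) point processes on `𝔸` whose expectation measure belongs to `C`. -/
def pointProcessesOver {𝔸 : Type*} [MeasurableSpace 𝔸] (C : Set (Measure 𝔸)) :
    Set (Measure (EmpiricalMeasure 𝔸)) :=
  {P | IsProbabilityMeasure P ∧ expectationMeasure P ∈ C}

/-- The Poisson distribution with mean `m ∈ [0, ∞]`, as a distribution on `[0, ∞]`;
for `m = ∞` it is the unit mass at `∞`. -/
def extPoisson (m : ℝ≥0∞) : Measure ℝ≥0∞ :=
  if m = ∞ then Measure.dirac ∞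
  else (poissonMeasure m.toNNReal).map (fun k : ℕ => (k : ℝ≥0∞))

/-- `Q` is (the law of) the Poisson point process `Po(ν)` with expectation measure `ν`:
the number of points in a measurable set `A` is Poisson distributed with mean `ν A`, and the
numbers of points in finitely many pairwise disjoint measurable sets are independent. -/
structure IsPoissonProcess {𝔸 : Type*} [MeasurableSpace 𝔸]
    (Q : Measure (EmpiricalMeasure 𝔸)) (ν : Measure 𝔸) : Prop where
  isProbabilityMeasure : IsProbabilityMeasure Q
  map_eval : ∀ A, MeasurableSet A →
    Q.map (fun η : EmpiricalMeasure 𝔸 => (η : Measure 𝔸) A) = extPoisson (ν A)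
  indep : ∀ (n : ℕ) (A : Fin n → Set 𝔸), (∀ i, MeasurableSet (A i)) →
    Pairwise (fun i j => Disjoint (A i) (A j)) →
    iIndepFun (fun (i : Fin n) (η : EmpiricalMeasure 𝔸) => (η : Measure 𝔸) (A i)) Q

end

/-! The core is a Pythagorean identity. If `P` has expectation measure `μ` and `Po(μ)` exists, then
D(P‖Po(ν)) = D(P‖Po(μ)) + D(μ‖ν) (`infoDiv_eq_add_of_isPoissonProcess`). Used for both `ν` and `ν*`,
it turns the claim into the projection inequality for `μ` plus D(C̃‖Po(ν)) ≤ D(C‖ν). The latter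
holds because `Po(μ)` is itself a competitor, with D(Po(μ)‖Po(ν)) = D(μ‖ν) by the same identity.

For a fixed finite partition the counts of a Poisson process are independent Poisson variables, and
the log-likelihood ratio of two such products is affine in the counts. Its integral under `P`
therefore depends only on the means (`infoDiv_pi_enatPoisson`). Divergences of point processes are
suprema over partitions of divergences of count vectors (`infoDiv_eq_iSup_cellCounts`): count events
form a generating algebra, and finite divergences are lower semicontinuous. Directedness under
refinement lets the supremum pass through the sum.

The remaining problem is the existence of `Po(μ)` for measures that need not be σ-finite. Where
D(P‖Po(ν)) = ∞ nothing is to be proved; otherwise D(μ‖ν) is finite, and a maximizing sequence of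
partitions shows that `μ` and `ν` coincide off a countable union of sets of finite measure
(`exists_partition_of_infoDiv_ne_top`). `Po(μ)` is then the superposition of a restricted copy of
`Po(ν)` and countably many independent Poisson processes with finite expectation measures. Laplace
functionals verify this. -/

/-! ### The divergence summand: duality, subadditivity, vanishing -/

lemma divTerm_top_top : divTerm ∞ ∞ = 0 := by simp [divTerm]

lemma divTerm_zero_right {x : ℝ≥0∞} (hx : x ≠ 0) : divTerm x 0 = ∞ := by
  simp [divTerm, hx]

lemma divTerm_zero_zero : divTerm 0 0 = 0 := by simp [divTerm]

lemma divTerm_top_right {x : ℝ≥0∞} (hx : x ≠ ∞) : divTerm x ∞ = ∞ := by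
  simp [divTerm, hx, divFun]

lemma divTerm_top_left {y : ℝ≥0∞} (hy : y ≠ ∞) : divTerm ∞ y = ∞ := by
  by_cases h0 : y = 0
  · simp [divTerm, h0]
  · simp [divTerm, hy, h0, divFun, ENNReal.top_div]

lemma divTerm_eq_ofReal {x y : ℝ≥0∞} (hx : x ≠ ∞) (hy : y ≠ ∞) (hy0 : y ≠ 0) :
    divTerm x y = ENNReal.ofReal
      (x.toReal * Real.log (x.toReal / y.toReal) - x.toReal + y.toReal) := by
  have hypos : 0 < y.toReal := ENNReal.toReal_pos hy0 hy
  have hxy : x / y ≠ ∞ := by simp [ENNReal.div_eq_top, hx, hy0]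
  rw [divTerm, if_neg (by simp [hx]), if_neg (by simp [hy0]), divFun, if_neg hxy]
  nth_rewrite 4 [← ENNReal.ofReal_toReal hy]
  rw [← ENNReal.ofReal_mul' hypos.le, ENNReal.toReal_div]
  congr 1
  field_simp
  ring

/-- The dual form of the divergence summand, a supremum of affine functions. -/
noncomputable def divDual (p : ℝ × ℝ) : ℝ≥0∞ :=
  ⨆ s : ℝ, ENNReal.ofReal (s * p.1 - (Real.exp s - 1) * p.2)

lemma lowerSemicontinuous_divDual : LowerSemicontinuous divDual := by
  refine lowerSemicontinuous_iSup fun s => Continuous.lowerSemicontinuous ?_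
  exact ENNReal.continuous_ofReal.comp (by fun_prop)

/-- Convex conjugation: the optimal slope is `s = log (x / y)`. It is only approached, as `s → -∞`,
when `x = 0 < y`, and the supremum is infinite when `y = 0 < x`. This form yields both subadditivity
and lower semicontinuity. -/
lemma divTerm_eq_divDual {x y : ℝ≥0∞} (hx : x ≠ ∞) (hy : y ≠ ∞) :
    divTerm x y = divDual (x.toReal, y.toReal) := by
  rcases eq_or_ne y 0 with rfl | hy0
  · rcases eq_or_ne x 0 with rfl | hx0
    · simp [divTerm_zero_zero, divDual]
    · rw [divTerm_zero_right hx0, eq_comm, divDual]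
      refine ENNReal.eq_top_of_forall_nnreal_le fun r => ?_
      have hxpos : 0 < x.toReal := ENNReal.toReal_pos hx0 hx
      refine le_iSup_of_le (r / x.toReal) ?_
      simp [hxpos.ne']
  have hypos : 0 < y.toReal := ENNReal.toReal_pos hy0 hy
  rw [divTerm_eq_ofReal hx hy hy0, divDual]
  apply le_antisymm
  · rcases eq_or_ne x 0 with rfl | hx0
    · have h : Filter.Tendsto (fun s : ℝ => ENNReal.ofReal (s * 0 - (Real.exp s - 1) * y.toReal))
          Filter.atBot (nhds (ENNReal.ofReal (0 * 0 - (0 - 1) * y.toReal))) := by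
        refine (ENNReal.continuous_ofReal.tendsto _).comp ?_
        simp only [mul_zero]
        exact (tendsto_const_nhds).sub ((Real.tendsto_exp_atBot.sub_const 1).mul_const _)
      have h2 := le_of_tendsto' h (fun s => le_iSup
        (fun s : ℝ => ENNReal.ofReal (s * 0 - (Real.exp s - 1) * y.toReal)) s)
      simpa using h2
    · have hxpos : 0 < x.toReal := ENNReal.toReal_pos hx0 hx
      refine le_iSup_of_le (Real.log (x.toReal / y.toReal)) ?_
      rw [Real.exp_log (by positivity)]
      apply ENNReal.ofReal_le_ofReal
      apply le_of_eq
      field_simp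
      ring
  · refine iSup_le fun s => ENNReal.ofReal_le_ofReal ?_
    simp only
    rcases eq_or_ne x 0 with rfl | hx0
    · simp; nlinarith [Real.exp_pos s]
    · have hxpos : 0 < x.toReal := ENNReal.toReal_pos hx0 hx
      have h := Real.add_one_le_exp (s - Real.log (x.toReal / y.toReal))
      rw [Real.exp_sub, Real.exp_log (by positivity)] at h
      have h3 : x.toReal * (s - Real.log (x.toReal / y.toReal) + 1) ≤ Real.exp s * y.toReal := by
        calc _ ≤ x.toReal * (Real.exp s / (x.toReal / y.toReal)) := by gcongr
          _ = _ := by field_simp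
      linarith

lemma ofReal_le_divTerm (s : ℝ) {x y : ℝ≥0∞} (hx : x ≠ ∞) (hy : y ≠ ∞) :
    ENNReal.ofReal (s * x.toReal - (Real.exp s - 1) * y.toReal) ≤ divTerm x y := by
  rw [divTerm_eq_divDual hx hy]
  exact le_iSup (fun s : ℝ => ENNReal.ofReal (s * x.toReal - (Real.exp s - 1) * y.toReal)) s

/-- Young's inequality with a nonnegative slope, free of subtraction; it bounds the first argument
by the divergence and the second. -/
lemma mul_le_divTerm_add (s : ℝ≥0) (x : ℝ≥0∞) {y : ℝ≥0∞} (hy : y ≠ ∞) :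
    s * x ≤ divTerm x y + ENNReal.ofReal (Real.exp s) * y := by
  rcases eq_or_ne x ∞ with rfl | hx
  · simp [divTerm_top_left hy]
  refine le_trans ?_ (add_le_add_left (ofReal_le_divTerm s hx hy) _)
  nth_rewrite 2 [← ENNReal.ofReal_toReal hy]
  nth_rewrite 1 [← ENNReal.ofReal_toReal hx]
  rw [← ENNReal.ofReal_mul (by positivity), ← ENNReal.ofReal_coe_nnreal,
    ← ENNReal.ofReal_mul (by positivity)]
  refine le_trans (ENNReal.ofReal_le_ofReal ?_) ENNReal.ofReal_add_le
  nlinarith [y.toReal_nonneg]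

/-- Young's inequality with slope `-1`; the positive coefficient gives the reverse control, of the
second argument by the first. -/
lemma le_divTerm_add_left {x : ℝ≥0∞} (y : ℝ≥0∞) (hx : x ≠ ∞) :
    ENNReal.ofReal (1 - Real.exp (-1)) * y ≤ divTerm x y + x := by
  rcases eq_or_ne y ∞ with rfl | hy
  · simp [divTerm_top_right hx]
  refine le_trans ?_ (add_le_add_left (ofReal_le_divTerm (-1) hx hy) _)
  nth_rewrite 2 [← ENNReal.ofReal_toReal hx]
  nth_rewrite 1 [← ENNReal.ofReal_toReal hy]
  rw [← ENNReal.ofReal_mul' (by positivity)]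
  refine le_trans (ENNReal.ofReal_le_ofReal ?_) ENNReal.ofReal_add_le
  linarith

lemma ofReal_tsum_le {ι : Type*} {a : ι → ℝ} (ha : Summable a) :
    ENNReal.ofReal (∑' k, a k) ≤ ∑' k, ENNReal.ofReal (a k) := by
  have hp : Summable fun k => max (a k) 0 :=
    Summable.of_nonneg_of_le (fun _ => le_max_right _ _)
      (fun k => max_le (le_abs_self _) (abs_nonneg _)) ha.abs
  calc ENNReal.ofReal (∑' k, a k) ≤ ENNReal.ofReal (∑' k, max (a k) 0) :=
        ENNReal.ofReal_le_ofReal (ha.tsum_le_tsum (fun _ => le_max_left _ _) hp)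
    _ = ∑' k, ENNReal.ofReal (max (a k) 0) :=
        ENNReal.ofReal_tsum_of_nonneg (fun _ => le_max_right _ _) hp
    _ = _ := by simp

/-- Joint subadditivity of the divergence summand: merging cells lowers the divergence. -/
lemma divTerm_tsum_le {ι : Type*} (x y : ι → ℝ≥0∞) :
    divTerm (∑' k, x k) (∑' k, y k) ≤ ∑' k, divTerm (x k) (y k) := by
  by_cases hx : ∑' k, x k = ∞ <;> by_cases hy : ∑' k, y k = ∞
  · rw [hx, hy, divTerm_top_top]; exact zero_le
  · have h : ∑' k, x k ≤ ∑' k, divTerm (x k) (y k) + ENNReal.ofReal (Real.exp 1) * ∑' k, y k := by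
      rw [← ENNReal.tsum_mul_left, ← ENNReal.tsum_add]
      refine ENNReal.tsum_le_tsum fun k => ?_
      simpa using mul_le_divTerm_add 1 (x k) (ENNReal.ne_top_of_tsum_ne_top hy k)
    rw [hx, top_le_iff, ENNReal.add_eq_top] at h
    rcases h with h | h
    · rw [h]; exact le_top
    · exact absurd h (ENNReal.mul_ne_top ENNReal.ofReal_ne_top hy)
  · have h : ENNReal.ofReal (1 - Real.exp (-1)) * ∑' k, y k
        ≤ ∑' k, divTerm (x k) (y k) + ∑' k, x k := by
      rw [← ENNReal.tsum_mul_left, ← ENNReal.tsum_add]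
      exact ENNReal.tsum_le_tsum fun k =>
        le_divTerm_add_left (y k) (ENNReal.ne_top_of_tsum_ne_top hx k)
    have hpos : ENNReal.ofReal (1 - Real.exp (-1)) ≠ 0 := by simp
    rw [hy, ENNReal.mul_top hpos, top_le_iff, ENNReal.add_eq_top] at h
    rcases h with h | h
    · rw [h]; exact le_top
    · exact absurd h hx
  · have hxk := ENNReal.ne_top_of_tsum_ne_top hx
    have hyk := ENNReal.ne_top_of_tsum_ne_top hy
    have sx := ENNReal.summable_toReal hx
    have sy := ENNReal.summable_toReal hy
    rw [divTerm_eq_divDual hx hy]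
    -- With finite totals, each member of the dual supremum is the positive part of a linear
    -- function of the pair, hence subadditive.
    refine iSup_le fun s => ?_
    simp only
    rw [ENNReal.tsum_toReal_eq hxk, ENNReal.tsum_toReal_eq hyk, ← tsum_mul_left, ← tsum_mul_left,
      ← (sx.mul_left s).tsum_sub (sy.mul_left _)]
    refine (ofReal_tsum_le ((sx.mul_left s).sub (sy.mul_left _))).trans ?_
    exact ENNReal.tsum_le_tsum fun k => ofReal_le_divTerm s (hxk k) (hyk k)

lemma divTerm_sum_le {ι : Type*} (t : Finset ι) (x y : ι → ℝ≥0∞) :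
    divTerm (∑ k ∈ t, x k) (∑ k ∈ t, y k) ≤ ∑ k ∈ t, divTerm (x k) (y k) := by
  have := divTerm_tsum_le (fun k : t => x k) (fun k : t => y k)
  simpa only [tsum_fintype, Finset.univ_eq_attach, Finset.sum_attach t x, Finset.sum_attach t y,
    Finset.sum_attach t (fun k => divTerm (x k) (y k))] using this

lemma divTerm_self (x : ℝ≥0∞) : divTerm x x = 0 := by
  rcases eq_or_ne x ∞ with rfl | hx
  · exact divTerm_top_top
  rcases eq_or_ne x 0 with rfl | h0
  · exact divTerm_zero_zero
  have := (ENNReal.toReal_pos h0 hx).ne'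
  rw [divTerm_eq_ofReal hx hx h0]; simp [this]

/-- For finite arguments the dual bounds say that `(exp s - 1) y - s x` is nonnegative in `s`. It
vanishes at `s = 0`, so its derivative `y - x` there is zero. -/
lemma eq_of_divTerm_eq_zero {x y : ℝ≥0∞} (h : divTerm x y = 0) : x = y := by
  rcases eq_or_ne x ∞ with rfl | hx
  · by_contra hy
    simp [divTerm_top_left (Ne.symm hy)] at h
  rcases eq_or_ne y ∞ with rfl | hy
  · simp [divTerm_top_right hx] at h
  have key : ∀ s : ℝ, s * x.toReal ≤ (Real.exp s - 1) * y.toReal := fun s => by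
    have := (ofReal_le_divTerm s hx hy).trans h.le
    simpa [ENNReal.ofReal_eq_zero] using this
  rcases eq_or_ne y 0 with rfl | hy0
  · by_contra hx0
    simp [divTerm_zero_right hx0] at h
  have hypos : 0 < y.toReal := ENNReal.toReal_pos hy0 hy
  have hd : HasDerivAt (fun s : ℝ => (Real.exp s - 1) * y.toReal - s * x.toReal)
      (Real.exp 0 * y.toReal - 1 * x.toReal) 0 :=
    (((Real.hasDerivAt_exp 0).sub_const 1).mul_const _).sub ((hasDerivAt_id 0).mul_const _)
  have hmin : IsLocalMin (fun s : ℝ => (Real.exp s - 1) * y.toReal - s * x.toReal) 0 :=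
    Filter.Eventually.of_forall fun s => by simpa using key s
  have h0 := hmin.hasDerivAt_eq_zero hd
  simp only [Real.exp_zero, one_mul] at h0
  exact (ENNReal.toReal_eq_toReal_iff' hx hy).1 (by linarith)

/-! ### Data processing and divergence on countable spaces -/

section InfoDiv
variable {X Y : Type*} [MeasurableSpace X] [MeasurableSpace Y]

lemma sum_divTerm_le_infoDiv {ι : Type*} [Fintype ι] (μ ν : Measure X) (g : X → ι)
    (hg : ∀ i, MeasurableSet (g ⁻¹' {i})) :
    ∑ i, divTerm (μ (g ⁻¹' {i})) (ν (g ⁻¹' {i})) ≤ infoDiv μ ν := by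
  let e := Fintype.equivFin ι
  have hpre : ∀ i, (e ∘ g) ⁻¹' {i} = g ⁻¹' {e.symm i} := fun i => by
    ext x; simp [Equiv.eq_symm_apply]
  have hm : Measurable (e ∘ g) := measurable_to_countable' fun i => by rw [hpre]; exact hg _
  unfold infoDiv
  refine le_trans (le_of_eq ?_) (le_iSup₂_of_le _ (e ∘ g) (le_iSup_of_le hm le_rfl))
  simp only [hpre]
  exact (Equiv.sum_comp e.symm (fun i => divTerm (μ (g ⁻¹' {i})) (ν (g ⁻¹' {i})))).symm

lemma divTerm_le_infoDiv (μ ν : Measure X) {A : Set X} (hA : MeasurableSet A) :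
    divTerm (μ A) (ν A) ≤ infoDiv μ ν := by
  classical
  let g : X → Fin 2 := fun x => if x ∈ A then 1 else 0
  have h := sum_divTerm_le_infoDiv μ ν g (fun i =>
    (Measurable.ite hA measurable_const measurable_const) (measurableSet_singleton i))
  rw [Fin.sum_univ_two] at h
  have : g ⁻¹' {1} = A := by ext x; simp [g]
  rw [this] at h
  exact le_add_self.trans h

lemma infoDiv_map_le (μ ν : Measure X) {φ : X → Y} (hφ : Measurable φ) :
    infoDiv (μ.map φ) (ν.map φ) ≤ infoDiv μ ν := by
  refine iSup₂_le fun n g => iSup_le fun hg => ?_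
  have h := sum_divTerm_le_infoDiv μ ν (g ∘ φ) (fun i => (hg.comp hφ) (measurableSet_singleton i))
  refine le_trans (le_of_eq (Finset.sum_congr rfl fun i _ => ?_)) h
  rw [Measure.map_apply hφ (hg (measurableSet_singleton i)),
    Measure.map_apply hφ (hg (measurableSet_singleton i))]
  rfl

lemma infoDiv_self (μ : Measure X) : infoDiv μ μ = 0 := by
  simp [infoDiv, divTerm_self]

/-- A fibre of a coarsening is the disjoint union of the finer fibres. -/
lemma measure_preimage_eq_sum {ι κ : Type*} [Fintype ι] [DecidableEq κ] (μ : Measure X)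
    (g : X → ι) (hg : ∀ i, MeasurableSet (g ⁻¹' {i})) (τ : ι → κ) (k : κ) :
    μ ((τ ∘ g) ⁻¹' {k}) = ∑ i with τ i = k, μ (g ⁻¹' {i}) := by
  have : (τ ∘ g) ⁻¹' {k} = ⋃ i ∈ Finset.univ.filter (fun i => τ i = k), g ⁻¹' {i} := by
    ext x; simp
  rw [this, measure_biUnion_finset]
  · intro i _ j _ hij
    exact Disjoint.preimage g (by simpa using hij)
  · exact fun i _ => hg i

lemma sum_divTerm_comp_le {ι κ : Type*} [Fintype ι] [Fintype κ] (μ ν : Measure X)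
    (g : X → ι) (hg : ∀ i, MeasurableSet (g ⁻¹' {i})) (τ : ι → κ) :
    ∑ k, divTerm (μ ((τ ∘ g) ⁻¹' {k})) (ν ((τ ∘ g) ⁻¹' {k}))
      ≤ ∑ i, divTerm (μ (g ⁻¹' {i})) (ν (g ⁻¹' {i})) := by
  classical
  rw [← Finset.sum_fiberwise Finset.univ τ]
  refine Finset.sum_le_sum fun k _ => ?_
  rw [measure_preimage_eq_sum μ g hg, measure_preimage_eq_sum ν g hg]
  exact divTerm_sum_le _ _ _

/-- Subadditivity makes the partition into points the finest bound. Conversely, any finite set of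
points is kept as singletons and the rest lumped into one cell. -/
lemma infoDiv_eq_tsum {K : Type*} [MeasurableSpace K] [Countable K] [MeasurableSingletonClass K]
    (μ ν : Measure K) : infoDiv μ ν = ∑' k, divTerm (μ {k}) (ν {k}) := by
  classical
  apply le_antisymm
  · refine iSup₂_le fun n g => iSup_le fun hg => ?_
    have hms : ∀ (ρ : Measure K) (i : Fin n),
        ρ (g ⁻¹' {i}) = ∑' k : g ⁻¹' {i}, ρ {(k : K)} := fun ρ i => by
      simpa using (tsum_measure_preimage_singleton (μ := ρ) (f := id)
        (Set.to_countable (g ⁻¹' {i})) (fun k _ => measurableSet_singleton k)).symm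
    calc ∑ i, divTerm (μ (g ⁻¹' {i})) (ν (g ⁻¹' {i}))
        ≤ ∑ i, ∑' k : g ⁻¹' {i}, divTerm (μ {(k : K)}) (ν {(k : K)}) :=
          Finset.sum_le_sum fun i _ => by rw [hms μ, hms ν]; exact divTerm_tsum_le _ _
      _ = ∑' k, divTerm (μ {k}) (ν {k}) := by
          rw [← tsum_fintype (L := .unconditional _), ← ENNReal.tsum_sigma]
          exact (Equiv.sigmaFiberEquiv g).tsum_eq (fun k => divTerm (μ {k}) (ν {k}))
  · rw [ENNReal.tsum_eq_iSup_sum]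
    refine iSup_le fun F => ?_
    let g : K → Option F := fun k => if h : k ∈ F then some ⟨k, h⟩ else none
    have h := sum_divTerm_le_infoDiv μ ν g (fun i => Set.to_countable _ |>.measurableSet)
    refine le_trans ?_ h
    rw [Fintype.sum_option]
    refine le_trans (le_of_eq ?_) le_add_self
    rw [← Finset.sum_coe_sort F]
    refine Finset.sum_congr rfl fun k _ => ?_
    have : g ⁻¹' {some k} = {(k : K)} := by
      ext x
      simp only [g, Set.mem_preimage, Set.mem_singleton_iff]
      split_ifs with hx
      · simp [Subtype.ext_iff]
      · simp only [false_iff]; rintro rfl; exact hx k.2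
    rw [this]

end InfoDiv

/-! ### Poisson laws on `ℕ∞` and the finite-dimensional splitting -/

/-- The Poisson distribution with mean `m ∈ [0, ∞]` as a distribution on `ℕ∞`. -/
noncomputable def enatPoisson (m : ℝ≥0∞) : Measure ℕ∞ :=
  if m = ∞ then Measure.dirac ⊤
  else (poissonMeasure m.toNNReal).map (fun k : ℕ => (k : ℕ∞))

lemma measurable_of_enat {β : Type*} [MeasurableSpace β] (f : ℕ∞ → β) : Measurable f :=
  measurable_from_top

instance (m : ℝ≥0∞) : IsProbabilityMeasure (enatPoisson m) := by
  unfold enatPoisson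
  split_ifs
  · infer_instance
  · exact Measure.isProbabilityMeasure_map (Measurable.aemeasurable (by fun_prop))

lemma enatPoisson_top_apply (k : ℕ∞) : enatPoisson ∞ {k} = if k = ⊤ then 1 else 0 := by
  classical
  rw [enatPoisson, if_pos rfl, Measure.dirac_apply' _ (measurableSet_singleton k)]
  simp [Set.indicator_apply, eq_comm]

lemma enatPoisson_apply_top {m : ℝ≥0∞} (hm : m ≠ ∞) : enatPoisson m {⊤} = 0 := by
  rw [enatPoisson, if_neg hm, Measure.map_apply (by fun_prop) (measurableSet_singleton _)]
  have : (fun k : ℕ => (k : ℕ∞)) ⁻¹' {⊤} = ∅ := by ext k; simp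
  rw [this, measure_empty]

lemma enatPoisson_apply_natCast {m : ℝ≥0∞} (hm : m ≠ ∞) (k : ℕ) : enatPoisson m {(k : ℕ∞)} =
    ENNReal.ofReal (Real.exp (-m.toReal) * m.toReal ^ k / k.factorial) := by
  rw [enatPoisson, if_neg hm, Measure.map_apply (by fun_prop) (measurableSet_singleton _)]
  have : (fun k : ℕ => (k : ℕ∞)) ⁻¹' {(k : ℕ∞)} = {k} := by ext j; simp
  rw [this, poissonMeasure_singleton]
  rfl

lemma lintegral_enatPoisson_exp_lt_top {m : ℝ≥0∞} (hm : m ≠ ∞) :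
    ∫⁻ k, ENNReal.ofReal (Real.exp k.toNat) ∂(enatPoisson m) < ∞ := by
  rw [enatPoisson, if_neg hm, lintegral_map (measurable_of_enat _) (by fun_prop),
    lintegral_countable']
  simp_rw [poissonMeasure_singleton, ← ENNReal.ofReal_mul (Real.exp_nonneg _)]
  have hs : Summable fun k : ℕ =>
      Real.exp (ENat.toNat (k : ℕ∞)) *
        (Real.exp (-m.toNNReal) * (m.toNNReal : ℝ) ^ k / k.factorial) := by
    have h := (Real.summable_pow_div_factorial (Real.exp 1 * m.toNNReal)).mul_left
      (Real.exp (-m.toNNReal))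
    refine h.congr fun k => ?_
    rw [mul_pow, ← Real.exp_nat_mul, ENat.toNat_natCast, mul_one]
    ring
  rw [← ENNReal.ofReal_tsum_of_nonneg (fun k => by positivity) hs]
  exact ENNReal.ofReal_lt_top

/-- The degenerate case of the splitting identity. Either `P` charges a point that is null for the
Poisson law, or an infinite mean faces a finite Poisson mean, and the exponential moment of the
latter rules out finite divergence. -/
lemma infoDiv_enatPoisson_eq_top (P : Measure ℕ∞) [IsProbabilityMeasure P] {y : ℝ≥0∞}
    (h : divTerm (∫⁻ k, (k : ℝ≥0∞) ∂P) y = ∞) : infoDiv P (enatPoisson y) = ∞ := by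
  have key : ∀ k : ℕ∞, P {k} ≠ 0 → enatPoisson y {k} = 0 → infoDiv P (enatPoisson y) = ∞ := by
    intro k h1 h2
    have := divTerm_le_infoDiv P (enatPoisson y) (measurableSet_singleton k)
    rwa [h2, divTerm_zero_right h1, top_le_iff] at this
  set x := ∫⁻ k, (k : ℝ≥0∞) ∂P with hx
  rcases eq_or_ne x ∞ with hxt | hxt
  · have hyt : y ≠ ∞ := by
      rintro rfl
      simp [hxt, divTerm_top_top] at h
    by_cases hP : P {⊤} = 0
    · have hle : x ≤ infoDiv P (enatPoisson y)
          + ∫⁻ k, ENNReal.ofReal (Real.exp k.toNat) ∂(enatPoisson y) := by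
        rw [hx, infoDiv_eq_tsum, lintegral_countable', lintegral_countable', ← ENNReal.tsum_add]
        refine ENNReal.tsum_le_tsum fun k => ?_
        rcases eq_or_ne k ⊤ with rfl | hk
        · simp [hP]
        -- The slope at the point `k` is `k` itself, so that summation yields: mean ≤ divergence +
        -- exponential moment.
        · have := mul_le_divTerm_add (k.toNat : ℝ≥0) (P {k})
            (y := enatPoisson y {k}) (measure_ne_top _ _)
          lift k to ℕ using hk
          simpa using this
      rw [hxt, top_le_iff, ENNReal.add_eq_top] at hle
      exact hle.resolve_right (lintegral_enatPoisson_exp_lt_top hyt).ne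
    · exact key ⊤ hP (enatPoisson_apply_top hyt)
  · have hex : ∀ (T : Set ℕ∞), P T ≠ 0 → ∃ k ∈ T, P {k} ≠ 0 := by
      intro T hT
      by_contra! hc
      refine hT ?_
      rw [← Set.biUnion_of_singleton T]
      exact (measure_biUnion_null_iff (Set.to_countable T)).2 hc
    rcases eq_or_ne y ∞ with rfl | hyt
    · have htop : P {⊤} = 0 := by
        by_contra hP
        apply hxt
        rw [hx, lintegral_countable']
        exact ENNReal.tsum_eq_top_of_eq_top ⟨⊤, by simp [hP]⟩
      obtain ⟨k, -, hk⟩ := hex Set.univ (by simp)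
      refine key k hk ?_
      rw [enatPoisson_top_apply, if_neg]
      rintro rfl
      exact hk htop
    · rcases eq_or_ne y 0 with rfl | hy0
      · have hx0 : x ≠ 0 := by
          intro h0
          simp [h0, divTerm_zero_zero] at h
        obtain ⟨k, hk0, hk⟩ := hex {k | k ≠ 0} (by
          intro hP
          apply hx0
          rw [hx, lintegral_eq_zero_iff (measurable_of_enat _)]
          refine measure_mono_null ?_ hP
          intro k hk
          simpa using hk)
        refine key k hk ?_
        rcases eq_or_ne k ⊤ with rfl | hkt
        · exact enatPoisson_apply_top (by simp)
        · lift k to ℕ using hkt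
          rw [enatPoisson_apply_natCast (by simp)]
          have : k ≠ 0 := by simpa using hk0
          simp [this]
      · rw [divTerm_eq_ofReal hxt hyt hy0] at h
        exact absurd h ENNReal.ofReal_ne_top

lemma mul_log_sub_add_nonneg {x y : ℝ} (hx : 0 ≤ x) (hy : 0 < y) :
    0 ≤ x * Real.log (x / y) - x + y := by
  rcases hx.eq_or_lt with rfl | hx
  · simpa using hy.le
  have h := Real.log_le_sub_one_of_pos (div_pos hy hx)
  have h2 : Real.log (x / y) = - Real.log (y / x) := by
    rw [← Real.log_inv, inv_div]
  rw [h2]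
  have h3 : x * Real.log (y / x) ≤ x * (y / x - 1) := by gcongr
  have h4 : x * (y / x - 1) = y - x := by field_simp
  linarith

/-- Change of the reference value in the divergence summand. -/
lemma divTerm_change_right {p q : ℝ≥0∞} (hp : p ≠ ∞) (hq : q ≠ ∞) {a b : ℝ}
    (ha : 0 ≤ a) (hb : 0 ≤ b) :
    divTerm p q + q * ENNReal.ofReal (Real.exp (a - b)) + p * ENNReal.ofReal b
      = divTerm p (q * ENNReal.ofReal (Real.exp (a - b))) + q + p * ENNReal.ofReal a := by
  rcases eq_or_ne q 0 with rfl | hq0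
  · rcases eq_or_ne p 0 with rfl | hp0
    · simp
    · simp [divTerm_zero_right hp0]
  have hqpos : 0 < q.toReal := ENNReal.toReal_pos hq0 hq
  have hepos := Real.exp_pos (a - b)
  set r := q * ENNReal.ofReal (Real.exp (a - b)) with hr
  have hrt : r ≠ ∞ := ENNReal.mul_ne_top hq ENNReal.ofReal_ne_top
  have hr0 : r ≠ 0 := mul_ne_zero hq0 (by simpa using hepos)
  have hrr : r.toReal = q.toReal * Real.exp (a - b) := by
    rw [hr, ENNReal.toReal_mul, ENNReal.toReal_ofReal hepos.le]
  have hrpos : 0 < r.toReal := ENNReal.toReal_pos hr0 hrt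
  have n1 := mul_log_sub_add_nonneg p.toReal_nonneg hqpos
  have n2 := mul_log_sub_add_nonneg p.toReal_nonneg hrpos
  rw [divTerm_eq_ofReal hp hq hq0, divTerm_eq_ofReal hp hrt hr0]
  have hP : ∀ c : ℝ, p * ENNReal.ofReal c = ENNReal.ofReal (p.toReal * c) := fun c => by
    rw [ENNReal.ofReal_mul p.toReal_nonneg, ENNReal.ofReal_toReal hp]
  have hR : ∀ t, t + r = t + ENNReal.ofReal r.toReal := fun t => by rw [ENNReal.ofReal_toReal hrt]
  have hQ : ∀ t, t + q = t + ENNReal.ofReal q.toReal := fun t => by rw [ENNReal.ofReal_toReal hq]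
  rw [hP, hP, hR, hQ, ← ENNReal.ofReal_add n1 hrpos.le, ← ENNReal.ofReal_add n2 hqpos.le,
    ← ENNReal.ofReal_add (by positivity) (by positivity),
    ← ENNReal.ofReal_add (by positivity) (by positivity)]
  congr 1
  rcases eq_or_ne p 0 with rfl | hp0
  · simp
    ring
  have hppos : 0 < p.toReal := ENNReal.toReal_pos hp0 hp
  have : Real.log (p.toReal / r.toReal) = Real.log (p.toReal / q.toReal) - (a - b) := by
    rw [hrr, ← div_div, Real.log_div (by positivity) hepos.ne', Real.log_exp]
  rw [this]
  ring

lemma divTerm_zero_left {y : ℝ≥0∞} (hy : y ≠ ∞) : divTerm 0 y = y := by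
  rcases eq_or_ne y 0 with rfl | h0
  · exact divTerm_zero_zero
  · rw [divTerm_eq_ofReal (by simp) hy h0]; simp [hy]

/-- The logarithmic ratio of two means, with the value `0` when it is undefined. -/
noncomputable def logRatio (x y : ℝ≥0∞) : ℝ := Real.log (x.toReal / y.toReal)

/-- This is `x log (x / y) - x + y` with the negative terms moved across. For `x = y = ∞` the
default values `logRatio = 0` and `toReal = 0` make both sides zero. -/
lemma divTerm_add_logRatio {x y : ℝ≥0∞} (h : divTerm x y ≠ ∞) :
    divTerm x y + (x * ENNReal.ofReal (-logRatio x y) + ENNReal.ofReal x.toReal)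
      = x * ENNReal.ofReal (logRatio x y) + ENNReal.ofReal y.toReal := by
  rcases eq_or_ne x ∞ with rfl | hx
  · have hy : y = ∞ := by by_contra hy; exact h (divTerm_top_left hy)
    simp [hy, divTerm_top_top, logRatio]
  have hy : y ≠ ∞ := by rintro rfl; exact h (divTerm_top_right hx)
  rcases eq_or_ne x 0 with rfl | hx0
  · simp [divTerm_zero_left hy, hy]
  have hy0 : y ≠ 0 := by rintro rfl; exact h (divTerm_zero_right hx0)
  have hxpos : 0 < x.toReal := ENNReal.toReal_pos hx0 hx
  have hypos : 0 < y.toReal := ENNReal.toReal_pos hy0 hy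
  have hc := divTerm_change_right hx hy (le_max_right (logRatio x y) 0)
    (le_max_right (-logRatio x y) 0)
  have he : max (logRatio x y) 0 - max (-logRatio x y) 0 = logRatio x y := by
    rcases le_total 0 (logRatio x y) with h | h
    · simp [h]
    · simp [h]
  have hxy : y * ENNReal.ofReal (Real.exp (logRatio x y)) = x := by
    nth_rewrite 1 [← ENNReal.ofReal_toReal hy]
    rw [logRatio, Real.exp_log (by positivity), ← ENNReal.ofReal_mul (by positivity),
      mul_div_cancel₀ _ hypos.ne', ENNReal.ofReal_toReal hx]
  have e0 : ∀ t : ℝ, ENNReal.ofReal (max t 0) = ENNReal.ofReal t := fun t => by simp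
  rw [he, hxy, divTerm_self, e0, e0] at hc
  rw [ENNReal.ofReal_toReal hx, ENNReal.ofReal_toReal hy, add_comm (x * _) x, ← add_assoc, hc]
  ring

/-- The likelihood ratio is `(x / y) ^ k * exp (y - x)`. The condition `hk` excludes the points
where the default `logRatio 0 y = 0` would give the wrong power. -/
lemma enatPoisson_change {x y : ℝ≥0∞} (h : divTerm x y ≠ ∞) {k : ℕ∞} (hk : x = 0 → k = 0) :
    enatPoisson x {k} = enatPoisson y {k} *
      ENNReal.ofReal (Real.exp (k.toNat * logRatio x y + y.toReal - x.toReal)) := by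
  rcases eq_or_ne x ∞ with rfl | hx
  · have hy : y = ∞ := by by_contra hy; exact h (divTerm_top_left hy)
    simp [hy, logRatio]
  have hy : y ≠ ∞ := by rintro rfl; exact h (divTerm_top_right hx)
  rcases eq_or_ne k ⊤ with rfl | hkt
  · simp [enatPoisson_apply_top hx, enatPoisson_apply_top hy]
  lift k to ℕ using hkt
  rw [enatPoisson_apply_natCast hx, enatPoisson_apply_natCast hy,
    ← ENNReal.ofReal_mul (by positivity)]
  congr 1
  rw [ENat.toNat_natCast]
  rcases eq_or_ne x 0 with rfl | hx0
  · have hk0 : k = 0 := by simpa using hk rfl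
    subst hk0
    simp [← Real.exp_add]
  have hy0 : y ≠ 0 := by rintro rfl; exact h (divTerm_zero_right hx0)
  have hxpos : 0 < x.toReal := ENNReal.toReal_pos hx0 hx
  have hypos : 0 < y.toReal := ENNReal.toReal_pos hy0 hy
  rw [show (k : ℝ) * logRatio x y + y.toReal - x.toReal
    = k * logRatio x y + (y.toReal + -x.toReal) by ring, Real.exp_add, Real.exp_add,
    Real.exp_nat_mul, logRatio, Real.exp_log (by positivity), div_pow, Real.exp_neg y.toReal]
  field_simp

/-- Relative to products of Poisson distributions, the divergence of a vector of counts
is the divergence from the Poisson product with the same means plus the divergence of the means. -/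
lemma infoDiv_pi_enatPoisson {n : ℕ} (P : Measure (Fin n → ℕ∞)) [IsProbabilityMeasure P]
    (x y : Fin n → ℝ≥0∞) (hx : ∀ i, ∫⁻ k, (k i : ℝ≥0∞) ∂P = x i) :
    infoDiv P (Measure.pi fun i => enatPoisson (y i))
      = infoDiv P (Measure.pi fun i => enatPoisson (x i)) + ∑ i, divTerm (x i) (y i) := by
  set Q := Measure.pi fun i => enatPoisson (y i) with hQ
  set R := Measure.pi fun i => enatPoisson (x i) with hR
  by_cases hfin : ∀ i, divTerm (x i) (y i) ≠ ∞
  swap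
  · push Not at hfin
    obtain ⟨i, hi⟩ := hfin
    have hsum : ∑ i, divTerm (x i) (y i) = ∞ := ENNReal.sum_eq_top.2 ⟨i, Finset.mem_univ i, hi⟩
    have := infoDiv_map_le P Q (measurable_pi_apply i)
    rw [hQ, (measurePreserving_eval (fun i => enatPoisson (y i)) i).map_eq] at this
    have hPi : IsProbabilityMeasure (P.map (Function.eval i)) :=
      Measure.isProbabilityMeasure_map (measurable_pi_apply i).aemeasurable
    rw [infoDiv_enatPoisson_eq_top (P.map (Function.eval i)) (by
      rw [lintegral_map (measurable_of_enat _) (measurable_pi_apply i)]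
      simpa only [Function.eval, hx i] using hi), top_le_iff] at this
    rw [hsum, this, add_top]
  set a : Fin n → ℝ := fun i => logRatio (x i) (y i) with ha
  -- `Lp - Lm` is the log-likelihood ratio of `R` against `Q`, with the signs separated to stay in
  -- `[0, ∞]`. Both parts are affine in the counts, so `hx` determines their integrals under `P`.
  set Lp : (Fin n → ℕ∞) → ℝ≥0∞ := fun k =>
    ∑ i, ((k i : ℝ≥0∞) * ENNReal.ofReal (a i) + ENNReal.ofReal (y i).toReal) with hLp
  set Lm : (Fin n → ℕ∞) → ℝ≥0∞ := fun k =>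
    ∑ i, ((k i : ℝ≥0∞) * ENNReal.ofReal (-a i) + ENNReal.ofReal (x i).toReal) with hLm
  have hint : ∀ c d : Fin n → ℝ, ∫⁻ k, ∑ i, ((k i : ℝ≥0∞) * ENNReal.ofReal (c i)
      + ENNReal.ofReal (d i)) ∂P = ∑ i, (x i * ENNReal.ofReal (c i) + ENNReal.ofReal (d i)) := by
    intro c d
    rw [lintegral_finsetSum' _ (fun i _ => (measurable_of_countable _).aemeasurable)]
    refine Finset.sum_congr rfl fun i _ => ?_
    rw [lintegral_add_right _ measurable_const, lintegral_mul_const _ (measurable_of_countable _),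
      hx i]
    simp
  -- Summed over `k`, the terms `R {k}` and `Q {k}` both contribute total mass one and cancel.
  have hpt : ∀ k, divTerm (P {k}) (Q {k}) + R {k} + P {k} * Lm k
      = divTerm (P {k}) (R {k}) + Q {k} + P {k} * Lp k := by
    intro k
    by_cases hk : ∀ i, x i = 0 → k i = 0
    · have hRk : R {k} = Q {k} * ENNReal.ofReal (Real.exp
          (∑ i, ((k i).toNat * a i + (y i).toReal - (x i).toReal))) := by
        rw [hR, hQ, Measure.pi_singleton, Measure.pi_singleton, Real.exp_sum,
          ENNReal.ofReal_prod_of_nonneg (fun i _ => (Real.exp_pos _).le), ← Finset.prod_mul_distrib]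
        exact Finset.prod_congr rfl fun i _ => enatPoisson_change (hfin i) (hk i)
      rcases eq_or_ne (Q {k}) 0 with hQ0 | hQ0
      · rw [hRk, hQ0, zero_mul, add_zero]
        rcases eq_or_ne (P {k}) 0 with hP0 | hP0
        · simp [hP0]
        · simp [divTerm_zero_right hP0]
      · have htop : ∀ i, k i = ⊤ → a i = 0 := by
          intro i hi
          have h0 : enatPoisson (y i) {k i} ≠ 0 := by
            rw [hQ, Measure.pi_singleton] at hQ0
            exact Finset.prod_ne_zero_iff.1 hQ0 i (Finset.mem_univ i)
          have hy : y i = ∞ := by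
            by_contra hy
            rw [hi] at h0
            exact h0 (enatPoisson_apply_top hy)
          simp [ha, logRatio, hy]
        have hL : ∀ c d : Fin n → ℝ, (∀ i, k i = ⊤ → c i = 0) → (∀ i, 0 ≤ d i) →
            ∑ i, ((k i : ℝ≥0∞) * ENNReal.ofReal (c i) + ENNReal.ofReal (d i))
              = ENNReal.ofReal (∑ i, ((k i).toNat * max (c i) 0 + d i)) := by
          intro c d hc hd
          rw [ENNReal.ofReal_sum_of_nonneg
            (fun i _ => add_nonneg (mul_nonneg (Nat.cast_nonneg _) (le_max_right _ _)) (hd i))]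
          refine Finset.sum_congr rfl fun i _ => ?_
          rw [ENNReal.ofReal_add (mul_nonneg (Nat.cast_nonneg _) (le_max_right _ _)) (hd i)]
          congr 1
          by_cases hi : k i = ⊤
          · simp [hi, hc i hi]
          · rw [ENNReal.ofReal_mul (Nat.cast_nonneg _)]
            lift k i to ℕ using hi with m
            simp
        rw [hLm, hLp]
        simp only
        rw [hL (fun i => -a i) _ (fun i hi => by simp [htop i hi])
            (fun i => ENNReal.toReal_nonneg),
          hL a _ htop (fun i => ENNReal.toReal_nonneg)]
        have hexp : ∑ i, ((k i).toNat * a i + (y i).toReal - (x i).toReal)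
            = ∑ i, ((k i).toNat * max (a i) 0 + (y i).toReal)
              - ∑ i, ((k i).toNat * max (-a i) 0 + (x i).toReal) := by
          rw [← Finset.sum_sub_distrib]
          refine Finset.sum_congr rfl fun i _ => ?_
          rcases le_total 0 (a i) with h | h <;> simp [h] <;> ring
        rw [hRk, hexp]
        have hnn : ∀ (c : Fin n → ℝ) (d : Fin n → ℝ≥0∞),
            0 ≤ ∑ i, ((k i).toNat * max (c i) 0 + (d i).toReal) := fun c d =>
          Finset.sum_nonneg fun i _ =>
            add_nonneg (mul_nonneg (Nat.cast_nonneg _) (le_max_right _ _)) ENNReal.toReal_nonneg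
        exact divTerm_change_right (measure_ne_top _ _) (measure_ne_top _ _) (hnn a y)
          (hnn (fun i => -a i) x)
    · push Not at hk
      obtain ⟨i, hi, hki⟩ := hk
      have hP0 : P {k} = 0 := by
        have h := hx i
        rw [hi, lintegral_eq_zero_iff (measurable_of_countable _)] at h
        refine measure_mono_null ?_ h
        rintro _ rfl
        simpa using hki
      have hR0 : R {k} = 0 := by
        rw [hR, Measure.pi_singleton]
        refine Finset.prod_eq_zero (Finset.mem_univ i) ?_
        rw [hi]
        rcases eq_or_ne (k i) ⊤ with hkt | hkt
        · rw [hkt]; exact enatPoisson_apply_top (by simp)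
        · lift k i to ℕ using hkt with m
          rw [enatPoisson_apply_natCast (by simp)]
          have : m ≠ 0 := by simpa using hki
          simp [this]
      rw [hP0, hR0, divTerm_zero_left (measure_ne_top _ _), divTerm_zero_zero]
      simp
  have htot : ∀ (S : Measure (Fin n → ℕ∞)) [IsProbabilityMeasure S], ∑' k, S {k} = 1 := by
    intro S _
    have := lintegral_countable' (μ := S) (fun _ => 1)
    simpa using this.symm
  have hsum := tsum_congr (L := .unconditional _) hpt
  have hQp : IsProbabilityMeasure Q := by rw [hQ]; infer_instance
  have hRp : IsProbabilityMeasure R := by rw [hR]; infer_instance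
  simp only [ENNReal.tsum_add] at hsum
  have hPL : ∀ L : (Fin n → ℕ∞) → ℝ≥0∞, ∑' k, P {k} * L k = ∫⁻ k, L k ∂P := fun L => by
    simp_rw [lintegral_countable', mul_comm]
  rw [hPL, hPL, htot Q, htot R,
    ← infoDiv_eq_tsum, ← infoDiv_eq_tsum, hint, hint] at hsum
  have hmean : ∑ i, divTerm (x i) (y i) + ∑ i, (x i * ENNReal.ofReal (-a i)
      + ENNReal.ofReal (x i).toReal)
      = ∑ i, (x i * ENNReal.ofReal (a i) + ENNReal.ofReal (y i).toReal) := by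
    rw [← Finset.sum_add_distrib]
    exact Finset.sum_congr rfl fun i _ => divTerm_add_logRatio (hfin i)
  rw [← hmean] at hsum
  -- Cancellation needs a finite term; a coordinate of infinite mean is harmless because its
  -- `logRatio` is zero.
  have hne : 1 + ∑ i, (x i * ENNReal.ofReal (-a i) + ENNReal.ofReal (x i).toReal) ≠ ∞ := by
    refine ENNReal.add_ne_top.2 ⟨by simp, ENNReal.sum_ne_top.2 fun i _ => ?_⟩
    refine ENNReal.add_ne_top.2 ⟨?_, ENNReal.ofReal_ne_top⟩
    rcases eq_or_ne (x i) ∞ with hi | hi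
    · simp [ha, logRatio, hi]
    · exact ENNReal.mul_ne_top hi ENNReal.ofReal_ne_top
  refine (ENNReal.add_left_inj hne).1 ?_
  rw [← add_assoc, hsum]
  ring

/-! ### Cell counts and the algebra they generate -/

section Counts
variable {𝔸 : Type*} [MeasurableSpace 𝔸]

/-- The numbers of points of an empirical measure in the cells of a finite partition. -/
noncomputable def cellCounts {n : ℕ} (g : 𝔸 → Fin n) (η : EmpiricalMeasure 𝔸) : Fin n → ℕ∞ :=
  fun i => ⌊(η : Measure 𝔸) (g ⁻¹' {i})⌋ₑ

lemma measurable_eval {A : Set 𝔸} (hA : MeasurableSet A) :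
    Measurable fun η : EmpiricalMeasure 𝔸 => (η : Measure 𝔸) A :=
  (Measure.measurable_coe hA).comp measurable_subtype_coe

lemma toENNReal_floor_eval (η : EmpiricalMeasure 𝔸) {A : Set 𝔸} (hA : MeasurableSet A) :
    (⌊(η : Measure 𝔸) A⌋ₑ : ℝ≥0∞) = (η : Measure 𝔸) A := by
  obtain ⟨k, hk⟩ := η.2 A hA
  rw [hk, ENat.floor_natCast]

/-- Fibres of a monotone map are order-connected, hence Borel. -/
lemma measurable_enat_floor : Measurable (ENat.floor : ℝ≥0∞ → ℕ∞) := by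
  refine ENat.measurable_iff.2 fun n => ?_
  exact (Set.OrdConnected.preimage_mono Set.ordConnected_singleton ENat.floor_mono).measurableSet

lemma measurable_cellCounts {n : ℕ} {g : 𝔸 → Fin n} (hg : Measurable g) :
    Measurable (cellCounts g) :=
  measurable_pi_lambda _ fun i =>
    measurable_enat_floor.comp (measurable_eval (hg (measurableSet_singleton i)))

lemma cellCounts_comp {n m : ℕ} {g : 𝔸 → Fin n} (hg : Measurable g) (τ : Fin n → Fin m)
    (η : EmpiricalMeasure 𝔸) :
    cellCounts (τ ∘ g) η = fun j => ∑ i with τ i = j, cellCounts g η i := by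
  have hgi : ∀ i, MeasurableSet (g ⁻¹' {i}) := fun i => hg (measurableSet_singleton i)
  ext j
  rw [cellCounts, measure_preimage_eq_sum _ g hgi τ j]
  have : ∑ i with τ i = j, (η : Measure 𝔸) (g ⁻¹' {i})
      = ((∑ i with τ i = j, cellCounts g η i : ℕ∞) : ℝ≥0∞) := by
    refine Eq.trans ?_ (map_sum ENat.toENNRealRingHom _ _).symm
    exact Finset.sum_congr rfl fun i _ => (toENNReal_floor_eval η (hgi i)).symm
  rw [this, ENat.floor_natCast]

/-- The algebra of sets of empirical measures defined by finitely many cell counts. -/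
def cylinderSets (𝔸 : Type*) [MeasurableSpace 𝔸] : Set (Set (EmpiricalMeasure 𝔸)) :=
  {B | ∃ (n : ℕ) (g : 𝔸 → Fin n), Measurable g ∧ ∃ T, B = cellCounts g ⁻¹' T}

/-- Finitely many finite partitions have a common finite refinement. -/
lemma exists_common_refinement {J : Type*} [Fintype J] (n : J → ℕ) (g : ∀ j, 𝔸 → Fin (n j))
    (hg : ∀ j, Measurable (g j)) :
    ∃ (N : ℕ) (G : 𝔸 → Fin N), Measurable G ∧ ∃ τ : ∀ j, Fin N → Fin (n j), ∀ j, g j = τ j ∘ G := by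
  classical
  let e := Fintype.equivFin (∀ j, Fin (n j))
  refine ⟨_, fun a => e (fun j => g j a), ?_, fun j i => e.symm i j, fun j => ?_⟩
  · exact (measurable_of_countable e).comp (measurable_pi_lambda _ hg)
  · ext a; simp

lemma exists_common_cellCounts {J : Type*} [Fintype J] (B : J → Set (EmpiricalMeasure 𝔸))
    (hB : ∀ j, B j ∈ cylinderSets 𝔸) :
    ∃ (N : ℕ) (G : 𝔸 → Fin N), Measurable G ∧
      ∃ T : J → Set (Fin N → ℕ∞), ∀ j, B j = cellCounts G ⁻¹' T j := by
  choose n g hg T hT using hB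
  obtain ⟨N, G, hG, τ, hτ⟩ := exists_common_refinement n g hg
  refine ⟨N, G, hG, fun j => (fun k l => ∑ i with τ j i = l, k i) ⁻¹' T j, fun j => ?_⟩
  rw [hT j]
  ext η
  rw [Set.mem_preimage, hτ j, cellCounts_comp hG]
  rfl

lemma isSetAlgebra_cylinderSets : IsSetAlgebra (cylinderSets 𝔸) where
  empty_mem := ⟨1, fun _ => 0, measurable_const, ∅, rfl⟩
  compl_mem := by
    rintro _ ⟨n, g, hg, T, rfl⟩
    exact ⟨n, g, hg, Tᶜ, rfl⟩
  union_mem := by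
    intro s t hs ht
    obtain ⟨N, G, hG, T, hT⟩ := exists_common_cellCounts (fun b : Bool => cond b s t)
      (by rintro (_ | _) <;> assumption)
    exact ⟨N, G, hG, T true ∪ T false, by
      rw [Set.preimage_union, ← hT, ← hT]; rfl⟩

lemma generateFrom_cylinderSets :
    (inferInstance : MeasurableSpace (EmpiricalMeasure 𝔸))
      = MeasurableSpace.generateFrom (cylinderSets 𝔸) := by
  classical
  apply le_antisymm
  · refine measurable_iff_comap_le.1 ?_
    refine @Measure.measurable_of_measurable_coe 𝔸 _ _
      (MeasurableSpace.generateFrom (cylinderSets 𝔸)) _ fun A hA => ?_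
    intro U _
    refine MeasurableSpace.measurableSet_generateFrom ⟨2, fun a => if a ∈ A then 1 else 0,
      Measurable.ite hA measurable_const measurable_const, {k | (k 1 : ℝ≥0∞) ∈ U}, ?_⟩
    ext η
    have : (fun a => if a ∈ A then (1 : Fin 2) else 0) ⁻¹' {1} = A := by ext; simp
    simp only [Set.mem_preimage, Set.mem_ofPred_eq, cellCounts, this, toENNReal_floor_eval η hA]
  · refine MeasurableSpace.generateFrom_le ?_
    rintro _ ⟨n, g, hg, T, rfl⟩
    exact measurable_cellCounts hg (Set.to_countable T).measurableSet

end Counts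

/-! ### Divergence of point processes through counts; the Pythagorean identity -/

section Cylinders
variable {𝔸 : Type*} [MeasurableSpace 𝔸]

/-- Finite measurable partitions, encoded by measurable maps to a finite set. -/
abbrev FinPartition (𝔸 : Type*) [MeasurableSpace 𝔸] : Type _ :=
  Σ n : ℕ, {g : 𝔸 → Fin n // Measurable g}

lemma infoDiv_eq_iSup_finPartition (μ ν : Measure 𝔸) : infoDiv μ ν =
    ⨆ G : FinPartition 𝔸, ∑ i, divTerm (μ (G.2.1 ⁻¹' {i})) (ν (G.2.1 ⁻¹' {i})) := by
  rw [infoDiv, iSup_sigma]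
  refine iSup_congr fun n => ?_
  rw [iSup_subtype]

/-- The divergence of two point processes is determined by their finite families of counts. -/
lemma infoDiv_eq_iSup_cellCounts (P Q : Measure (EmpiricalMeasure 𝔸)) [IsFiniteMeasure P]
    [IsFiniteMeasure Q] : infoDiv P Q =
      ⨆ G : FinPartition 𝔸, infoDiv (P.map (cellCounts G.2.1)) (Q.map (cellCounts G.2.1)) := by
  classical
  apply le_antisymm
  swap
  · exact iSup_le fun G => infoDiv_map_le P Q (measurable_cellCounts G.2.2)
  refine iSup₂_le fun m h => iSup_le fun hh => ?_
  set V := ⨆ G : FinPartition 𝔸, infoDiv (P.map (cellCounts G.2.1)) (Q.map (cellCounts G.2.1))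
  rcases isEmpty_or_nonempty (EmpiricalMeasure 𝔸) with hE | ⟨⟨η₀⟩⟩
  · have : ∀ i, h ⁻¹' {i} = ∅ := fun i => Subsingleton.elim _ _
    simp [this, divTerm_zero_zero]
  set F : (Fin m → ℝ × ℝ) → ℝ≥0∞ := fun v => ∑ i, divDual (v i) with hF
  set w : (EmpiricalMeasure 𝔸 → Fin m) → (Fin m → ℝ × ℝ) :=
    fun f i => (P.real (f ⁻¹' {i}), Q.real (f ⁻¹' {i})) with hw
  have hFw : ∀ f, ∑ i, divTerm (P (f ⁻¹' {i})) (Q (f ⁻¹' {i})) = F (w f) := fun f =>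
    Finset.sum_congr rfl fun i _ => divTerm_eq_divDual (measure_ne_top _ _) (measure_ne_top _ _)
  have hlsc : LowerSemicontinuous F := lowerSemicontinuous_sum fun i _ =>
    lowerSemicontinuous_divDual.comp (continuous_apply i)
  -- Lower semicontinuity reduces the bound to partitions by count events, provided these
  -- approximate the cells of `h` arbitrarily well in `P` and `Q` measure.
  have hclosed : IsClosed (F ⁻¹' Set.Iic V) := hlsc.isClosed_preimage V
  rw [hFw]
  suffices w h ∈ closure (F ⁻¹' Set.Iic V) by rwa [hclosed.closure_eq] at this
  rw [Metric.mem_closure_iff]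
  intro ε hε
  have hdense := Measure.MeasureDense.of_generateFrom_isSetAlgebra_finite (P + Q)
    isSetAlgebra_cylinderSets (generateFrom_cylinderSets (𝔸 := 𝔸))
  -- Chosen so that the `m` approximation errors add up to less than `ε`, also when `m = 0`.
  have hδ : 0 < ε / (2 * (m + 1)) := by positivity
  have happ : ∀ j, ∃ B ∈ cylinderSets 𝔸, (P + Q) (symmDiff (h ⁻¹' {j}) B)
      < ENNReal.ofReal (ε / (2 * (m + 1))) := fun j =>
    hdense.approx _ (hh (measurableSet_singleton j)) (measure_ne_top _ _) _ hδ
  choose B hB hBlt using happ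
  obtain ⟨N, G, hG, T, hT⟩ := exists_common_cellCounts B hB
  have hBm : ∀ j, MeasurableSet (B j) := fun j => hdense.measurable _ (hB j)
  -- The approximating sets `B j` need not form a partition: a count vector lying in exactly one `T
  -- j` gets the label `j`, any other an arbitrary label. Off `Z` the first case occurs, with the
  -- label given by `h`.
  let σ : (Fin N → ℕ∞) → Fin m := fun k =>
    if hk : ∃ j, ∀ i, (k ∈ T i ↔ i = j) then hk.choose else h η₀
  let f : EmpiricalMeasure 𝔸 → Fin m := σ ∘ cellCounts G
  set Z := ⋃ j, symmDiff (h ⁻¹' {j}) (B j) with hZ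
  have hfh : ∀ η ∉ Z, f η = h η := by
    intro η hη
    have hiff : ∀ i, (cellCounts G η ∈ T i ↔ i = h η) := by
      intro i
      simp only [hZ, Set.mem_iUnion, not_exists, Set.mem_symmDiff, not_or, not_and, not_not] at hη
      have h1 := hη i
      rw [hT i] at h1
      simp only [Set.mem_preimage, Set.mem_singleton_iff] at h1
      exact ⟨fun h => (h1.2 h).symm, fun h => h1.1 h.symm⟩
    have hk : ∃ j, ∀ i, (cellCounts G η ∈ T i ↔ i = j) := ⟨h η, hiff⟩
    have h2 : f η = hk.choose := dif_pos hk
    rw [h2]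
    exact (hk.choose_spec (h η)).1 ((hiff _).2 rfl) |>.symm
  have hfm : Measurable f := (measurable_of_countable σ).comp (measurable_cellCounts hG)
  refine ⟨w f, ?_, ?_⟩
  · rw [Set.mem_preimage, Set.mem_Iic, ← hFw]
    refine le_trans ?_ (le_iSup (fun G : FinPartition 𝔸 =>
      infoDiv (P.map (cellCounts G.2.1)) (Q.map (cellCounts G.2.1))) ⟨N, G, hG⟩)
    have hσ := sum_divTerm_le_infoDiv (P.map (cellCounts G)) (Q.map (cellCounts G)) σ
      (fun i => (Set.to_countable _).measurableSet)
    refine le_trans (le_of_eq (Finset.sum_congr rfl fun i _ => ?_)) hσ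
    rw [Measure.map_apply (measurable_cellCounts hG) (Set.to_countable _).measurableSet,
      Measure.map_apply (measurable_cellCounts hG) (Set.to_countable _).measurableSet]
    rfl
  · have hZlt : (P + Q).real Z ≤ m * (ε / (2 * (m + 1))) := by
      refine (measureReal_iUnion_fintype_le _).trans ?_
      calc _ ≤ ∑ _j : Fin m, ε / (2 * (m + 1)) := Finset.sum_le_sum fun j _ =>
            ENNReal.toReal_le_of_le_ofReal hδ.le (hBlt j).le
        _ = _ := by simp
    have hZε : (P + Q).real Z < ε := by
      refine hZlt.trans_lt ?_
      rw [mul_div_assoc', div_lt_iff₀ (by positivity)]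
      nlinarith [(Nat.cast_nonneg m : (0 : ℝ) ≤ m)]
    have hsub : ∀ i, symmDiff (h ⁻¹' {i}) (f ⁻¹' {i}) ⊆ Z := by
      intro i η hη
      by_contra hnot
      have := hfh η hnot
      simp [Set.mem_symmDiff, this] at hη
    have hd : ∀ (ρ : Measure (EmpiricalMeasure 𝔸)) [IsFiniteMeasure ρ], ρ ≤ P + Q →
        ∀ i, dist (ρ.real (h ⁻¹' {i})) (ρ.real (f ⁻¹' {i})) < ε := by
      intro ρ _ hρ i
      rw [Real.dist_eq]
      refine (abs_measureReal_sub_le_measureReal_symmDiff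
        (hh (measurableSet_singleton i)).nullMeasurableSet
        (hfm (measurableSet_singleton i)).nullMeasurableSet).trans_lt (lt_of_le_of_lt ?_ hZε)
      refine (measureReal_mono (hsub i)).trans ?_
      exact ENNReal.toReal_mono (measure_ne_top _ _) (hρ Z)
    rw [dist_pi_lt_iff hε]
    intro i
    rw [Prod.dist_eq, max_lt_iff]
    exact ⟨hd P (Measure.le_add_right le_rfl) i, hd Q (Measure.le_add_left le_rfl) i⟩

lemma map_floor_extPoisson (m : ℝ≥0∞) : (extPoisson m).map ENat.floor = enatPoisson m := by
  unfold extPoisson enatPoisson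
  split_ifs with hm
  · rw [Measure.map_dirac' measurable_enat_floor, ENat.floor_top]
  · rw [Measure.map_map measurable_enat_floor (measurable_of_countable _)]
    congr 1
    ext k
    exact ENat.floor_natCast (k : ℕ∞)

lemma IsPoissonProcess.map_cellCounts {Q : Measure (EmpiricalMeasure 𝔸)} {ν : Measure 𝔸}
    (hQ : IsPoissonProcess Q ν) {n : ℕ} {g : 𝔸 → Fin n} (hg : Measurable g) :
    Q.map (cellCounts g) = Measure.pi fun i => enatPoisson (ν (g ⁻¹' {i})) := by
  have := hQ.isProbabilityMeasure
  have hgi : ∀ i, MeasurableSet (g ⁻¹' {i}) := fun i => hg (measurableSet_singleton i)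
  have hind := (hQ.indep n (fun i => g ⁻¹' {i}) hgi (fun i j hij =>
    Disjoint.preimage g (by simpa using hij))).comp (fun _ => ENat.floor)
      (fun _ => measurable_enat_floor)
  rw [iIndepFun_iff_map_fun_eq_pi_map
    (fun i => (measurable_enat_floor.comp (measurable_eval (hgi i))).aemeasurable)] at hind
  refine hind.trans ?_
  congr 1
  ext1 i
  rw [← Measure.map_map measurable_enat_floor (measurable_eval (hgi i)), hQ.map_eval _ (hgi i),
    map_floor_extPoisson]

lemma expectationMeasure_apply (P : Measure (EmpiricalMeasure 𝔸)) {A : Set 𝔸}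
    (hA : MeasurableSet A) : expectationMeasure P A = ∫⁻ η, (η : Measure 𝔸) A ∂P :=
  Measure.bind_apply hA measurable_subtype_coe.aemeasurable

lemma infoDiv_cellCounts_eq {P Q : Measure (EmpiricalMeasure 𝔸)} [IsProbabilityMeasure P]
    {ν : Measure 𝔸} (hQ : IsPoissonProcess Q ν) {n : ℕ} {g : 𝔸 → Fin n} (hg : Measurable g) :
    infoDiv (P.map (cellCounts g)) (Q.map (cellCounts g))
      = infoDiv (P.map (cellCounts g))
          (Measure.pi fun i => enatPoisson (expectationMeasure P (g ⁻¹' {i})))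
        + ∑ i, divTerm (expectationMeasure P (g ⁻¹' {i})) (ν (g ⁻¹' {i})) := by
  have : IsProbabilityMeasure (P.map (cellCounts g)) :=
    Measure.isProbabilityMeasure_map (measurable_cellCounts hg).aemeasurable
  rw [hQ.map_cellCounts hg]
  refine infoDiv_pi_enatPoisson _ _ _ fun i => ?_
  rw [lintegral_map (measurable_of_countable _) (measurable_cellCounts hg),
    expectationMeasure_apply P (hg (measurableSet_singleton i))]
  exact lintegral_congr fun η => toENNReal_floor_eval η (hg (measurableSet_singleton i))

/-- Dropping the nonnegative count term in each partition avoids assuming a Poisson process over the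
expectation measure of `P`; its existence is derived later from this very bound. -/
lemma infoDiv_expectationMeasure_le {P Q : Measure (EmpiricalMeasure 𝔸)} [IsProbabilityMeasure P]
    {ν : Measure 𝔸} (hQ : IsPoissonProcess Q ν) :
    infoDiv (expectationMeasure P) ν ≤ infoDiv P Q := by
  have := hQ.isProbabilityMeasure
  rw [infoDiv_eq_iSup_cellCounts, infoDiv_eq_iSup_finPartition]
  refine iSup_mono fun G => ?_
  rw [infoDiv_cellCounts_eq hQ G.2.2]
  exact le_add_self

/-- The divergence from a Poisson process splits through the Poisson process with the same
expectation measure. -/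
lemma infoDiv_eq_add_of_isPoissonProcess {P Q R : Measure (EmpiricalMeasure 𝔸)}
    [IsProbabilityMeasure P] {ν : Measure 𝔸} (hQ : IsPoissonProcess Q ν)
    (hR : IsPoissonProcess R (expectationMeasure P)) :
    infoDiv P Q = infoDiv P R + infoDiv (expectationMeasure P) ν := by
  have := hQ.isProbabilityMeasure
  have := hR.isProbabilityMeasure
  rw [infoDiv_eq_iSup_cellCounts P Q, infoDiv_eq_iSup_cellCounts P R,
    infoDiv_eq_iSup_finPartition, ENNReal.iSup_add_iSup]
  · refine iSup_congr fun G => ?_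
    rw [infoDiv_cellCounts_eq hQ G.2.2, hR.map_cellCounts G.2.2]
  -- Both families increase under refinement, so a common refinement dominates one term from each.
  · rintro ⟨n, g, hg⟩ ⟨m, g', hg'⟩
    obtain ⟨N, G, hG, τ, hτ⟩ := exists_common_refinement (J := Bool) (fun b => cond b n m)
      (fun b => match b with
        | true => g
        | false => g') (by rintro (_ | _) <;> assumption)
    have h1 : g = τ true ∘ G := hτ true
    have h2 : g' = τ false ∘ G := hτ false
    refine ⟨⟨N, G, hG⟩, add_le_add ?_ ?_⟩
    · have hc : cellCounts g = (fun (k : Fin N → ℕ∞) j => ∑ i with τ true i = j, k i)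
          ∘ cellCounts G := by
        ext η : 1
        rw [h1]
        exact cellCounts_comp hG _ η
      simp only
      rw [hc, ← Measure.map_map (measurable_of_countable _) (measurable_cellCounts hG),
        ← Measure.map_map (measurable_of_countable _) (measurable_cellCounts hG)]
      exact infoDiv_map_le _ _ (measurable_of_countable _)
    · subst h2
      exact sum_divTerm_comp_le _ _ G (fun i => hG (measurableSet_singleton i)) _

end Cylinders

/-! ### Laplace transforms on `[0, ∞]ⁿ` -/

/-- The function `x ↦ exp (-x)` on `[0, ∞]`. -/
noncomputable def expNeg (x : ℝ≥0∞) : ℝ≥0∞ := (EReal.exp x)⁻¹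

lemma expNeg_zero : expNeg 0 = 1 := by simp [expNeg]

lemma expNeg_top : expNeg ∞ = 0 := by simp [expNeg]

lemma expNeg_add (x y : ℝ≥0∞) : expNeg (x + y) = expNeg x * expNeg y := by
  have h : ∀ z : ℝ≥0∞, EReal.exp z ≠ 0 := fun z => by simp [EReal.exp_eq_zero_iff]
  rw [expNeg, expNeg, expNeg, EReal.coe_ennreal_add, EReal.exp_add,
    ENNReal.mul_inv (Or.inl (h x)) (Or.inr (h y))]

lemma expNeg_sum {ι : Type*} (t : Finset ι) (x : ι → ℝ≥0∞) :
    expNeg (∑ i ∈ t, x i) = ∏ i ∈ t, expNeg (x i) := by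
  classical
  induction t using Finset.induction_on with
  | empty => simp [expNeg_zero]
  | insert i t hi ih => rw [Finset.sum_insert hi, Finset.prod_insert hi, expNeg_add, ih]

lemma expNeg_le_one (x : ℝ≥0∞) : expNeg x ≤ 1 := by
  rw [expNeg, ENNReal.inv_le_one, EReal.one_le_exp_iff]
  exact EReal.coe_ennreal_nonneg x

lemma expNeg_ofReal {r : ℝ} (hr : 0 ≤ r) :
    expNeg (ENNReal.ofReal r) = ENNReal.ofReal (Real.exp (-r)) := by
  rw [expNeg, EReal.coe_ennreal_ofReal, max_eq_left hr, EReal.exp_coe, Real.exp_neg,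
    ENNReal.ofReal_inv_of_pos (Real.exp_pos r)]

lemma expNeg_eq_ofReal {x : ℝ≥0∞} (hx : x ≠ ∞) :
    expNeg x = ENNReal.ofReal (Real.exp (-x.toReal)) := by
  rw [← expNeg_ofReal ENNReal.toReal_nonneg, ENNReal.ofReal_toReal hx]

lemma continuous_expNeg : Continuous expNeg :=
  continuous_inv.comp (ENNReal.continuous_exp.comp continuous_coe_ennreal_ereal)

lemma expNeg_injective : Function.Injective expNeg := by
  intro x y h
  have := EReal.exp_strictMono.injective (inv_injective h)
  exact_mod_cast this

lemma tendsto_prod_expNeg (x : ℕ → ℝ≥0∞) :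
    Filter.Tendsto (fun N => ∏ k ∈ Finset.range N, expNeg (x k)) Filter.atTop
      (nhds (expNeg (∑' k, x k))) := by
  simp_rw [← expNeg_sum]
  exact (continuous_expNeg.tendsto _).comp ENNReal.summable.hasSum.tendsto_sum_nat

lemma tsum_mul_pow_div_factorial (m : ℝ≥0∞) {a : ℝ≥0∞} (ha : a ≠ ∞) :
    ∑' k : ℕ, ENNReal.ofReal (Real.exp (-m.toReal) / k.factorial) * a ^ k
      = ENNReal.ofReal (Real.exp (a.toReal - m.toReal)) := by
  have h : ∀ k : ℕ, ENNReal.ofReal (Real.exp (-m.toReal) / k.factorial) * a ^ k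
      = ENNReal.ofReal (Real.exp (-m.toReal) * (a.toReal ^ k / k.factorial)) := fun k => by
    nth_rewrite 1 [← ENNReal.ofReal_toReal ha]
    rw [← ENNReal.ofReal_pow ENNReal.toReal_nonneg, ← ENNReal.ofReal_mul (by positivity)]
    congr 1
    ring
  simp_rw [h]
  rw [← ENNReal.ofReal_tsum_of_nonneg (fun k => by positivity)
    ((Real.summable_pow_div_factorial _).mul_left _), tsum_mul_left, sub_eq_neg_add, Real.exp_add,
    Real.exp_eq_exp_ℝ, NormedSpace.exp_eq_tsum_div]

/-- The Poisson Laplace transform `∫ exp(-s x)` has exponent `(1 - exp(-s))` times the mean. -/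
noncomputable def lapCoeff (s : ℕ) : ℝ≥0∞ := 1 - expNeg 1 ^ s

lemma expNeg_one_pow (s : ℕ) : expNeg 1 ^ s = ENNReal.ofReal (Real.exp (-s)) := by
  rw [expNeg_eq_ofReal (by simp), ← ENNReal.ofReal_pow (Real.exp_nonneg _), ← Real.exp_nat_mul]
  simp

lemma lapCoeff_eq (s : ℕ) : lapCoeff s = ENNReal.ofReal (1 - Real.exp (-s)) := by
  rw [lapCoeff, expNeg_one_pow, ENNReal.ofReal_sub _ (Real.exp_nonneg _), ENNReal.ofReal_one]

lemma measurable_expNeg : Measurable expNeg := continuous_expNeg.measurable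

/-- The Poisson generating function at `exp (-s)`. The case `m = ∞`, `s = 0` relies on `0 * ∞ = 0`,
matching `expNeg ∞ ^ 0 = 1`. -/
lemma lintegral_expNeg_pow_extPoisson (m : ℝ≥0∞) (s : ℕ) :
    ∫⁻ x, expNeg x ^ s ∂(extPoisson m) = expNeg (lapCoeff s * m) := by
  have hmeas : Measurable fun x => expNeg x ^ s := measurable_expNeg.pow_const s
  unfold extPoisson
  split_ifs with hm
  · rw [lintegral_dirac' _ hmeas, hm, expNeg_top]
    rcases Nat.eq_zero_or_pos s with rfl | hs
    · simp [lapCoeff, expNeg_zero]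
    · have : lapCoeff s ≠ 0 := by
        rw [lapCoeff_eq]
        simpa using hs.ne'
      rw [ENNReal.mul_top this, expNeg_top, zero_pow hs.ne']
  · rw [lintegral_map hmeas (measurable_of_countable _), lintegral_countable']
    have h : ∀ k : ℕ, expNeg (k : ℝ≥0∞) ^ s * poissonMeasure m.toNNReal {k}
        = ENNReal.ofReal (Real.exp (-m.toReal) / k.factorial) * (expNeg 1 ^ s * m) ^ k := fun k => by
      have h1 : expNeg (k : ℝ≥0∞) = expNeg 1 ^ k := by
        have := expNeg_sum (Finset.range k) (fun _ => (1 : ℝ≥0∞))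
        simpa using this
      rw [poissonMeasure_singleton, h1, mul_pow, ← pow_mul, ← pow_mul, mul_comm k s]
      have h2 : ENNReal.ofReal (Real.exp (-m.toNNReal) * (m.toNNReal : ℝ) ^ k / k.factorial)
          = ENNReal.ofReal (Real.exp (-m.toReal) / k.factorial) * m ^ k := by
        have h3 : m ^ k = ENNReal.ofReal (m.toReal ^ k) := by
          rw [ENNReal.ofReal_pow ENNReal.toReal_nonneg, ENNReal.ofReal_toReal hm]
        rw [h3, ← ENNReal.ofReal_mul (by positivity)]
        congr 1
        rw [ENNReal.coe_toNNReal_eq_toReal]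
        ring
      rw [h2]
      ring
    simp_rw [h]
    have hs : expNeg 1 ^ s ≠ ∞ := by rw [expNeg_one_pow]; exact ENNReal.ofReal_ne_top
    have hc : lapCoeff s ≠ ∞ := by rw [lapCoeff_eq]; exact ENNReal.ofReal_ne_top
    rw [tsum_mul_pow_div_factorial m (ENNReal.mul_ne_top hs hm),
      expNeg_eq_ofReal (ENNReal.mul_ne_top hc hm), ENNReal.toReal_mul, ENNReal.toReal_mul,
      lapCoeff_eq, expNeg_one_pow, ENNReal.toReal_ofReal (Real.exp_nonneg _),
      ENNReal.toReal_ofReal (by simp)]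
    congr 2
    ring

lemma lintegral_prod_expNeg_pow_pi {n : ℕ} (P : Fin n → Measure ℝ≥0∞)
    [∀ i, IsProbabilityMeasure (P i)] (s : Fin n → ℕ) :
    ∫⁻ x, ∏ i, expNeg (x i) ^ s i ∂(Measure.pi P) = ∏ i, ∫⁻ x, expNeg x ^ s i ∂(P i) := by
  have hm : ∀ i, Measurable fun x => expNeg x ^ s i := fun i => measurable_expNeg.pow_const _
  have hind : iIndepFun (fun i (x : Fin n → ℝ≥0∞) => expNeg (x i) ^ s i) (Measure.pi P) :=
    iIndepFun_pi (X := fun i x => expNeg x ^ s i) (fun i => (hm i).aemeasurable)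
  rw [lintegral_prod_eq_prod_lintegral_of_indepFun _ _ hind
    (fun i => (hm i).comp (measurable_pi_apply i))]
  refine Finset.prod_congr rfl fun i _ => ?_
  rw [← (measurePreserving_eval P i).lintegral_comp (hm i)]

open BoundedContinuousFunction in
/-- Finite measures on `[0, ∞]ⁿ` are determined by their Laplace transforms at integer points. -/
lemma ext_of_lintegral_prod_expNeg_pow {n : ℕ} {P P' : Measure (Fin n → ℝ≥0∞)}
    [IsFiniteMeasure P] [IsFiniteMeasure P']
    (h : ∀ s : Fin n → ℕ, ∫⁻ x, ∏ i, expNeg (x i) ^ s i ∂P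
      = ∫⁻ x, ∏ i, expNeg (x i) ^ s i ∂P') : P = P' := by
  classical
  have hne : ∀ x, expNeg x ≠ ∞ := fun x => ((expNeg_le_one x).trans_lt ENNReal.one_lt_top).ne
  have hcont : Continuous fun x => (expNeg x).toReal :=
    ENNReal.continuousOn_toReal.comp_continuous continuous_expNeg hne
  let f : Fin n → ((Fin n → ℝ≥0∞) →ᵇ ℝ) := fun i =>
    BoundedContinuousFunction.ofNormedAddCommGroup (fun x => (expNeg (x i)).toReal)
      (hcont.comp (continuous_apply i)) 1 (fun x => by
        rw [Real.norm_of_nonneg ENNReal.toReal_nonneg]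
        exact ENNReal.toReal_le_of_le_ofReal zero_le_one (by simpa using expNeg_le_one _))
  -- The coordinate functions `exp (-x i)` separate points, and the algebra they generate is spanned
  -- by monomials, whose integrals are the given Laplace transforms.
  let A : StarSubalgebra ℝ ((Fin n → ℝ≥0∞) →ᵇ ℝ) :=
    { Algebra.adjoin ℝ (Set.range f) with
      star_mem' := fun {a} ha => by
        have : star a = a := by ext x; simp
        rwa [this] }
  refine ext_of_forall_mem_subalgebra_integral_eq_of_polish (A := A) ?_ ?_
  · intro x y hxy
    obtain ⟨i, hi⟩ := Function.ne_iff.1 hxy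
    refine ⟨f i, ⟨toContinuousMapStarₐ ℝ (f i), ⟨f i, Algebra.subset_adjoin ⟨i, rfl⟩, rfl⟩, rfl⟩,
      fun heq => hi ?_⟩
    exact expNeg_injective ((ENNReal.toReal_eq_toReal_iff' (hne _) (hne _)).1 heq)
  · intro g hg
    replace hg : g ∈ Algebra.adjoin ℝ (Set.range f) := hg
    rw [← Subalgebra.mem_toSubmodule, Algebra.adjoin_eq_span] at hg
    induction hg using Submodule.span_induction with
    | mem g hg =>
      have hmono : ∃ s : Fin n → ℕ, g = ∏ i, f i ^ s i := by
        induction hg using Submonoid.closure_induction with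
        | mem g hg =>
          obtain ⟨i, rfl⟩ := hg
          refine ⟨Pi.single i 1, ?_⟩
          rw [Finset.prod_eq_single i (fun j _ hj => by simp [hj]) (by simp)]
          simp
        | one => exact ⟨0, by simp⟩
        | mul a b _ _ iha ihb =>
          obtain ⟨s, rfl⟩ := iha
          obtain ⟨t, rfl⟩ := ihb
          exact ⟨s + t, by simp [pow_add, Finset.prod_mul_distrib]⟩
      obtain ⟨s, rfl⟩ := hmono
      have hval : ∀ x, (∏ i, f i ^ s i : (Fin n → ℝ≥0∞) →ᵇ ℝ) x
          = (∏ i, expNeg (x i) ^ s i).toReal := by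
        intro x
        rw [ENNReal.toReal_prod]
        simp [f, BoundedContinuousFunction.coe_prod]
      have hm : Measurable fun x : Fin n → ℝ≥0∞ => ∏ i, expNeg (x i) ^ s i :=
        Finset.measurable_prod _ fun i _ =>
          (measurable_expNeg.comp (measurable_pi_apply i)).pow_const _
      have hlt : ∀ x : Fin n → ℝ≥0∞, ∏ i, expNeg (x i) ^ s i < ∞ := fun x =>
        (ENNReal.prod_ne_top fun i _ => ENNReal.pow_ne_top (hne _)).lt_top
      simp_rw [hval]
      rw [integral_toReal hm.aemeasurable (Filter.Eventually.of_forall hlt),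
        integral_toReal hm.aemeasurable (Filter.Eventually.of_forall hlt), h s]
    | zero => simp
    | add a b _ _ iha ihb =>
      simp only [BoundedContinuousFunction.coe_add, Pi.add_apply]
      rw [integral_add (a.integrable P) (b.integrable P),
        integral_add (a.integrable P') (b.integrable P'), iha, ihb]
    | smul c a _ iha =>
      simp only [BoundedContinuousFunction.coe_smul]
      rw [integral_smul, integral_smul, iha]

/-! ### Construction of Poisson processes by Laplace functionals -/

section Construction
variable {𝔸 : Type*} [MeasurableSpace 𝔸]

/-- The law `P` has the Laplace functional of the Poisson process with expectation measure `μ`. -/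
def HasPoissonLaplace (P : Measure (EmpiricalMeasure 𝔸)) (μ : Measure 𝔸) : Prop :=
  ∀ (n : ℕ) (A : Fin n → Set 𝔸), (∀ i, MeasurableSet (A i)) →
    Pairwise (fun i j => Disjoint (A i) (A j)) → ∀ s : Fin n → ℕ,
    ∫⁻ η, ∏ i, expNeg ((η : Measure 𝔸) (A i)) ^ s i ∂P = expNeg (∑ i, lapCoeff (s i) * μ (A i))

lemma measurable_prod_expNeg_eval {n : ℕ} {A : Fin n → Set 𝔸} (hA : ∀ i, MeasurableSet (A i))
    (s : Fin n → ℕ) : Measurable fun η : EmpiricalMeasure 𝔸 =>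
      ∏ i, expNeg ((η : Measure 𝔸) (A i)) ^ s i :=
  Finset.measurable_prod _ fun i _ =>
    (measurable_expNeg.comp (measurable_eval (hA i))).pow_const _

lemma prod_expNeg_pow_le_one {n : ℕ} (x : Fin n → ℝ≥0∞) (s : Fin n → ℕ) :
    ∏ i, expNeg (x i) ^ s i ≤ 1 :=
  Finset.prod_le_one' fun _ _ => pow_le_one' (expNeg_le_one _) _

instance (m : ℝ≥0∞) : IsProbabilityMeasure (extPoisson m) := by
  unfold extPoisson
  split_ifs
  · infer_instance
  · exact Measure.isProbabilityMeasure_map (measurable_of_countable _).aemeasurable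

lemma IsPoissonProcess.hasPoissonLaplace {Q : Measure (EmpiricalMeasure 𝔸)} {ν : Measure 𝔸}
    (hQ : IsPoissonProcess Q ν) : HasPoissonLaplace Q ν := by
  intro n A hA hdisj s
  have hm : ∀ i, Measurable fun x => expNeg x ^ s i := fun i => measurable_expNeg.pow_const _
  have hind := (hQ.indep n A hA hdisj).comp (fun i x => expNeg x ^ s i) hm
  rw [expNeg_sum]
  refine (lintegral_prod_eq_prod_lintegral_of_indepFun Finset.univ _ hind
    (fun i => (hm i).comp (measurable_eval (hA i)))).trans ?_
  refine Finset.prod_congr rfl fun i _ => ?_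
  rw [← lintegral_expNeg_pow_extPoisson, ← hQ.map_eval _ (hA i),
    lintegral_map (hm i) (measurable_eval (hA i))]
  rfl

/-- The functional factors over disjoint sets, so uniqueness of Laplace transforms identifies the
joint law of the counts with a product; marginals and independence follow together. -/
lemma HasPoissonLaplace.isPoissonProcess {P : Measure (EmpiricalMeasure 𝔸)}
    [IsProbabilityMeasure P] {μ : Measure 𝔸} (hP : HasPoissonLaplace P μ) :
    IsPoissonProcess P μ := by
  have hlaw : ∀ (n : ℕ) (A : Fin n → Set 𝔸), (∀ i, MeasurableSet (A i)) →
      Pairwise (fun i j => Disjoint (A i) (A j)) →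
      P.map (fun (η : EmpiricalMeasure 𝔸) i => (η : Measure 𝔸) (A i)) = Measure.pi fun i => extPoisson (μ (A i)) := by
    intro n A hA hdisj
    have hmeas : Measurable fun (η : EmpiricalMeasure 𝔸) i => (η : Measure 𝔸) (A i) :=
      measurable_pi_lambda _ fun i => measurable_eval (hA i)
    have := Measure.isProbabilityMeasure_map (μ := P) hmeas.aemeasurable
    refine ext_of_lintegral_prod_expNeg_pow fun s => ?_
    have hm : Measurable fun x : Fin n → ℝ≥0∞ => ∏ i, expNeg (x i) ^ s i :=
      Finset.measurable_prod _ fun i _ =>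
        (measurable_expNeg.comp (measurable_pi_apply i)).pow_const _
    rw [lintegral_map hm hmeas, hP n A hA hdisj s,
      lintegral_prod_expNeg_pow_pi, expNeg_sum]
    exact Finset.prod_congr rfl fun i _ => (lintegral_expNeg_pow_extPoisson _ _).symm
  have heval : ∀ A, MeasurableSet A →
      P.map (fun η : EmpiricalMeasure 𝔸 => (η : Measure 𝔸) A) = extPoisson (μ A) := by
    intro A hA
    have h1 := hlaw 1 (fun _ => A) (fun _ => hA) (fun i j hij => absurd (Subsingleton.elim i j) hij)
    have h2 := congrArg (Measure.map (Function.eval 0)) h1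
    rwa [(measurePreserving_eval _ 0).map_eq, Measure.map_map (measurable_pi_apply 0)
      (measurable_pi_lambda _ fun i => measurable_eval hA)] at h2
  refine ⟨inferInstance, heval, fun n A hA hdisj => ?_⟩
  rw [iIndepFun_iff_map_fun_eq_pi_map (fun i => (measurable_eval (hA i)).aemeasurable),
    hlaw n A hA hdisj]
  congr 1
  ext1 i
  exact (heval _ (hA i)).symm

/-- The restriction of an empirical measure. -/
noncomputable def EmpiricalMeasure.restrict (η : EmpiricalMeasure 𝔸) {S : Set 𝔸}
    (hS : MeasurableSet S) : EmpiricalMeasure 𝔸 :=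
  ⟨(η : Measure 𝔸).restrict S, fun A hA => by
    rw [Measure.restrict_apply hA]; exact η.2 _ (hA.inter hS)⟩

lemma measurable_to_empiricalMeasure {Ω : Type*} [MeasurableSpace Ω] {f : Ω → EmpiricalMeasure 𝔸}
    (hf : ∀ A, MeasurableSet A → Measurable fun ω => (f ω : Measure 𝔸) A) : Measurable f :=
  (Measure.measurable_of_measurable_coe _ hf).subtype_mk

/-- Serves the part of the space where no σ-finiteness is available: a Poisson process there is
inherited from the given one. -/
lemma exists_hasPoissonLaplace_restrict {Q : Measure (EmpiricalMeasure 𝔸)}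
    [IsProbabilityMeasure Q] {ν : Measure 𝔸} (hQ : HasPoissonLaplace Q ν) {S : Set 𝔸}
    (hS : MeasurableSet S) :
    ∃ P : Measure (EmpiricalMeasure 𝔸), IsProbabilityMeasure P ∧
      HasPoissonLaplace P (ν.restrict S) := by
  have hm : Measurable fun η : EmpiricalMeasure 𝔸 => η.restrict hS :=
    measurable_to_empiricalMeasure fun A hA => by
      simp only [EmpiricalMeasure.restrict, Measure.restrict_apply hA]
      exact measurable_eval (hA.inter hS)
  refine ⟨Q.map fun η => η.restrict hS, Measure.isProbabilityMeasure_map hm.aemeasurable, ?_⟩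
  intro n A hA hdisj s
  rw [lintegral_map (measurable_prod_expNeg_eval hA s) hm]
  simp only [EmpiricalMeasure.restrict, Measure.restrict_apply (hA _)]
  exact hQ n (fun i => A i ∩ S) (fun i => (hA i).inter hS)
    (fun i j hij => (hdisj hij).mono Set.inter_subset_left Set.inter_subset_left) s

/-- The image of `ℕ∞` in `[0, ∞]` is closed and contains the finite partial sums. -/
lemma exists_enat_tsum {ι : Type*} {x : ι → ℝ≥0∞} (hx : ∀ k, ∃ m : ℕ∞, x k = m) :
    ∃ m : ℕ∞, ∑' k, x k = m := by
  choose m hm using hx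
  have hmem : ∑' k, x k ∈ Set.range ENat.toENNReal :=
    ENat.isClosedEmbedding_toENNReal.isClosed_range.mem_of_tendsto
      (ENNReal.summable (f := x)).hasSum (Filter.Eventually.of_forall fun t =>
        ⟨∑ k ∈ t, m k, by
          refine (map_sum ENat.toENNRealRingHom _ _).trans ?_
          exact Finset.sum_congr rfl fun k _ => (hm k).symm⟩)
  obtain ⟨j, hj⟩ := hmem
  exact ⟨j, hj.symm⟩

/-- The superposition of a sequence of empirical measures. -/
noncomputable def EmpiricalMeasure.superpose (η : ℕ → EmpiricalMeasure 𝔸) : EmpiricalMeasure 𝔸 :=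
  ⟨Measure.sum fun k => (η k : Measure 𝔸), fun A hA => by
    rw [Measure.sum_apply _ hA]; exact exists_enat_tsum fun k => (η k).2 A hA⟩

/-- Superposing independent processes multiplies their Laplace functionals; dominated convergence,
with bound `1`, handles the infinite product. -/
lemma exists_hasPoissonLaplace_sum (μ : ℕ → Measure 𝔸)
    (h : ∀ k, ∃ P : Measure (EmpiricalMeasure 𝔸), IsProbabilityMeasure P ∧
      HasPoissonLaplace P (μ k)) :
    ∃ P : Measure (EmpiricalMeasure 𝔸), IsProbabilityMeasure P ∧
      HasPoissonLaplace P (Measure.sum μ) := by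
  choose P hP hL using h
  have hm : Measurable (EmpiricalMeasure.superpose (𝔸 := 𝔸)) :=
    measurable_to_empiricalMeasure fun A hA => by
      simp only [EmpiricalMeasure.superpose, Measure.sum_apply _ hA]
      exact Measurable.tsum fun k => (measurable_eval hA).comp (measurable_pi_apply k)
  refine ⟨(Measure.infinitePi P).map EmpiricalMeasure.superpose,
    Measure.isProbabilityMeasure_map hm.aemeasurable, ?_⟩
  intro n A hA hdisj s
  rw [lintegral_map (measurable_prod_expNeg_eval hA s) hm]
  simp only [EmpiricalMeasure.superpose, Measure.sum_apply _ (hA _)]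
  set Φ : ℕ → (ℕ → EmpiricalMeasure 𝔸) → ℝ≥0∞ := fun k η =>
    ∏ i, expNeg ((η k : Measure 𝔸) (A i)) ^ s i with hΦ
  have hΦm : ∀ k, Measurable (Φ k) := fun k =>
    (measurable_prod_expNeg_eval hA s).comp (measurable_pi_apply k)
  have hind : iIndepFun Φ (Measure.infinitePi P) :=
    iIndepFun_infinitePi (X := fun _ (η : EmpiricalMeasure 𝔸) =>
      ∏ i, expNeg ((η : Measure 𝔸) (A i)) ^ s i) (fun k => measurable_prod_expNeg_eval hA s)
  have hint : ∀ N, ∫⁻ η, ∏ k ∈ Finset.range N, Φ k η ∂(Measure.infinitePi P)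
      = ∏ k ∈ Finset.range N, expNeg (∑ i, lapCoeff (s i) * μ k (A i)) := by
    intro N
    rw [lintegral_prod_eq_prod_lintegral_of_indepFun _ _ hind hΦm]
    refine Finset.prod_congr rfl fun k _ => ?_
    rw [← hL k n A hA hdisj s]
    exact (measurePreserving_eval_infinitePi P k).lintegral_comp (measurable_prod_expNeg_eval hA s)
  have hlim : Filter.Tendsto (fun N => ∫⁻ η, ∏ k ∈ Finset.range N, Φ k η ∂(Measure.infinitePi P))
      Filter.atTop (nhds (∫⁻ η, ∏ i, expNeg (∑' k, (η k : Measure 𝔸) (A i)) ^ s i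
        ∂(Measure.infinitePi P))) := by
    refine tendsto_lintegral_of_dominated_convergence (fun _ => 1)
      (fun N => Finset.measurable_prod _ fun k _ => hΦm k) (fun N => ?_) (by simp) ?_
    · exact Filter.Eventually.of_forall fun η =>
        Finset.prod_le_one' fun k _ => prod_expNeg_pow_le_one _ _
    · refine Filter.Eventually.of_forall fun η => ?_
      have hcomm : ∀ N, ∏ k ∈ Finset.range N, Φ k η
          = ∏ i, (∏ k ∈ Finset.range N, expNeg ((η k : Measure 𝔸) (A i))) ^ s i := fun N => by
        simp only [hΦ]
        rw [Finset.prod_comm]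
        simp_rw [Finset.prod_pow]
      simp_rw [hcomm]
      have hne : ∀ x, expNeg x ≠ ∞ := fun x => ((expNeg_le_one x).trans_lt ENNReal.one_lt_top).ne
      refine ENNReal.tendsto_finsetProd_of_ne_top _ (fun i _ => ?_)
        (fun i _ => ENNReal.pow_ne_top (hne _))
      exact ((ENNReal.continuous_pow (s i)).tendsto _).comp (tendsto_prod_expNeg _)
  refine tendsto_nhds_unique hlim ?_
  simp_rw [hint]
  have h2 := tendsto_prod_expNeg fun k => ∑ i, lapCoeff (s i) * μ k (A i)
  have h3 : ∑' k, ∑ i, lapCoeff (s i) * μ k (A i) = ∑ i, lapCoeff (s i) * ∑' k, μ k (A i) := by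
    rw [Summable.tsum_finsetSum fun i _ => ENNReal.summable]
    simp_rw [ENNReal.tsum_mul_left]
  rwa [h3] at h2

/-- The empirical measure of finitely many points. -/
noncomputable def EmpiricalMeasure.ofPoints {N : ℕ} (x : Fin N → 𝔸) : EmpiricalMeasure 𝔸 :=
  ⟨Measure.sum fun j => Measure.dirac (x j), fun A hA => by
    classical
    rw [Measure.sum_apply _ hA]
    refine exists_enat_tsum fun j => ⟨if x j ∈ A then 1 else 0, ?_⟩
    rw [Measure.dirac_apply' _ hA, Set.indicator_apply]
    split_ifs <;> simp⟩

lemma EmpiricalMeasure.ofPoints_apply {N : ℕ} (x : Fin N → 𝔸) {A : Set 𝔸} (hA : MeasurableSet A) :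
    (EmpiricalMeasure.ofPoints x : Measure 𝔸) A = ∑ j, A.indicator 1 (x j) := by
  simp only [EmpiricalMeasure.ofPoints, Measure.sum_apply _ hA, Measure.dirac_apply' _ hA,
    tsum_fintype]

lemma measurable_ofPoints {N : ℕ} :
    Measurable (EmpiricalMeasure.ofPoints : (Fin N → 𝔸) → EmpiricalMeasure 𝔸) :=
  measurable_to_empiricalMeasure fun A hA => by
    simp_rw [EmpiricalMeasure.ofPoints_apply _ hA]
    exact Finset.measurable_sum _ fun j _ =>
      (measurable_one.indicator hA).comp (measurable_pi_apply j)

lemma lintegral_pi_prod_eq_pow (μ : Measure 𝔸) [IsFiniteMeasure μ] {φ : 𝔸 → ℝ≥0∞}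
    (hφ : Measurable φ) (hφ1 : ∀ a, φ a ≤ 1) (N : ℕ) :
    ∫⁻ x : Fin N → 𝔸, ∏ j, φ (x j) ∂(Measure.pi fun _ => μ) = (∫⁻ a, φ a ∂μ) ^ N := by
  have hne : ∀ a, φ a ≠ ∞ := fun a => ((hφ1 a).trans_lt ENNReal.one_lt_top).ne
  have hprod : ∀ x : Fin N → 𝔸, ∏ j, φ (x j) ≤ 1 := fun x => Finset.prod_le_one' fun j _ => hφ1 _
  have hpm : Measurable fun x : Fin N → 𝔸 => ∏ j, φ (x j) :=
    Finset.measurable_prod _ fun j _ => hφ.comp (measurable_pi_apply j)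
  have hfin1 : ∫⁻ x : Fin N → 𝔸, ∏ j, φ (x j) ∂(Measure.pi fun _ => μ) ≠ ∞ :=
    ((lintegral_mono hprod).trans_lt (by simp [measure_lt_top])).ne
  have hfin2 : ∫⁻ a, φ a ∂μ ≠ ∞ := ((lintegral_mono hφ1).trans_lt (by simp [measure_lt_top])).ne
  rw [← ENNReal.toReal_eq_toReal_iff' hfin1 (ENNReal.pow_ne_top hfin2), ENNReal.toReal_pow,
    ← integral_toReal hpm.aemeasurable
      (Filter.Eventually.of_forall fun x => (hprod x).trans_lt ENNReal.one_lt_top),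
    ← integral_toReal hφ.aemeasurable (Filter.Eventually.of_forall fun a => (hne a).lt_top)]
  simp_rw [ENNReal.toReal_prod]
  have := integral_fintype_prod_eq_pow (ι := Fin N) (μ := μ) (fun a => (φ a).toReal)
  simpa using this

lemma exists_hasPoissonLaplace_of_isFiniteMeasure (μ : Measure 𝔸) [IsFiniteMeasure μ] :
    ∃ P : Measure (EmpiricalMeasure 𝔸), IsProbabilityMeasure P ∧ HasPoissonLaplace P μ := by
  set m := μ Set.univ with hm
  have hmt : m ≠ ∞ := measure_ne_top _ _
  -- A Poisson number of independent points. The unnormalized powers of `μ` absorb the factor `m ^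
  -- N`, so no division by `m` is needed and `m = 0` is included.
  set P : Measure (EmpiricalMeasure 𝔸) := Measure.sum fun N : ℕ =>
    ENNReal.ofReal (Real.exp (-m.toReal) / N.factorial) •
      (Measure.pi fun _ : Fin N => μ).map EmpiricalMeasure.ofPoints with hP
  have hL : HasPoissonLaplace P μ := by
    intro n A hA hdisj s
    classical
    set φ : 𝔸 → ℝ≥0∞ := fun a => ∏ i, expNeg ((A i).indicator 1 a) ^ s i with hφ
    have hφm : Measurable φ := Finset.measurable_prod _ fun i _ =>
      (measurable_expNeg.comp (measurable_one.indicator (hA i))).pow_const _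
    have hφ1 : ∀ a, φ a ≤ 1 := fun a => prod_expNeg_pow_le_one _ _
    set c := ∑ i, lapCoeff (s i) * μ (A i) with hc
    have hcoeff : ∀ k, lapCoeff k ≠ ∞ := fun k => by
      rw [lapCoeff_eq]; exact ENNReal.ofReal_ne_top
    have hct : c ≠ ∞ := ENNReal.sum_ne_top.2 fun i _ =>
      ENNReal.mul_ne_top (hcoeff _) (measure_ne_top _ _)
    -- By disjointness each point lies in at most one `A i`, which turns the product `φ` into an
    -- affine expression in indicators.
    have hsplit : ∀ a, φ a + ∑ i, lapCoeff (s i) * (A i).indicator 1 a = 1 := by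
      intro a
      have hle : ∀ i, expNeg 1 ^ s i + lapCoeff (s i) = 1 := fun i =>
        add_tsub_cancel_of_le (pow_le_one' (expNeg_le_one 1) _)
      by_cases ha : ∃ i, a ∈ A i
      · obtain ⟨i, hi⟩ := ha
        have hother : ∀ j, j ≠ i → a ∉ A j := fun j hj haj =>
          Set.disjoint_left.1 (hdisj hj) haj hi
        rw [hφ]
        simp only
        rw [Finset.prod_eq_single i (fun j _ hj => by simp [hother j hj, expNeg_zero]) (by simp),
          Finset.sum_eq_single i (fun j _ hj => by simp [hother j hj]) (by simp)]
        simpa [hi] using hle i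
      · push Not at ha
        simp [hφ, ha, expNeg_zero]
    have hφint : ∫⁻ a, φ a ∂μ + c = m := by
      have h1 : ∫⁻ a, (φ a + ∑ i, lapCoeff (s i) * (A i).indicator 1 a) ∂μ = m := by
        simp [hsplit, hm]
      rw [lintegral_add_left hφm, lintegral_finsetSum _ (fun i _ =>
        (measurable_one.indicator (hA i)).const_mul _)] at h1
      rw [← h1, hc]
      congr 1
      refine Finset.sum_congr rfl fun i _ => ?_
      rw [lintegral_const_mul _ (measurable_one.indicator (hA i)), lintegral_indicator_one (hA i)]
    have hφt : ∫⁻ a, φ a ∂μ ≠ ∞ := ne_top_of_le_ne_top hmt (hφint ▸ le_self_add)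
    have hterm : ∀ N : ℕ, ∫⁻ x : Fin N → 𝔸, ∏ i,
        expNeg ((EmpiricalMeasure.ofPoints x : Measure 𝔸) (A i)) ^ s i ∂(Measure.pi fun _ => μ)
          = (∫⁻ a, φ a ∂μ) ^ N := by
      intro N
      rw [← lintegral_pi_prod_eq_pow μ hφm hφ1 N]
      refine lintegral_congr fun x => ?_
      simp only [hφ]
      rw [Finset.prod_comm]
      refine Finset.prod_congr rfl fun i _ => ?_
      rw [EmpiricalMeasure.ofPoints_apply x (hA i), expNeg_sum, Finset.prod_pow]
    rw [hP, lintegral_sum_measure]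
    simp_rw [lintegral_smul_measure,
      lintegral_map (measurable_prod_expNeg_eval hA s) measurable_ofPoints, hterm, smul_eq_mul]
    rw [tsum_mul_pow_div_factorial m hφt, expNeg_eq_ofReal hct]
    congr 2
    rw [← hφint, ENNReal.toReal_add hφt hct]
    ring
  refine ⟨P, ⟨?_⟩, hL⟩
  -- The Laplace functional of the empty family is the total mass.
  have := hL 0 (fun _ => ∅) (fun _ => MeasurableSet.empty) (fun i => i.elim0) (fun _ => 0)
  simpa [expNeg_zero] using this

end Construction

/-! ### Existence at finite divergence, and the projection theorem -/

section Projection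
variable {𝔸 : Type*} [MeasurableSpace 𝔸]

lemma measure_eq_top_iff_of_infoDiv_ne_top {μ ν : Measure 𝔸} (h : infoDiv μ ν ≠ ∞) {A : Set 𝔸}
    (hA : MeasurableSet A) : μ A = ∞ ↔ ν A = ∞ := by
  have hle := divTerm_le_infoDiv μ ν hA
  constructor <;> intro h1 <;> by_contra h2 <;> rw [h1] at hle
  · exact h (top_le_iff.1 (divTerm_top_left h2 ▸ hle))
  · exact h (top_le_iff.1 (divTerm_top_right h2 ▸ hle))

/-- Splitting off a set that meets only cells of infinite measure adds its divergence. -/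
lemma sum_divTerm_add_divTerm_le_infoDiv {μ ν : Measure 𝔸} (h : infoDiv μ ν ≠ ∞) {n : ℕ}
    {g : 𝔸 → Fin n} (hg : Measurable g) {B : Set 𝔸} (hB : MeasurableSet B)
    (hBg : ∀ i, ν (g ⁻¹' {i}) ≠ ∞ → Disjoint (g ⁻¹' {i}) B) :
    ∑ i, divTerm (μ (g ⁻¹' {i})) (ν (g ⁻¹' {i})) + divTerm (μ B) (ν B) ≤ infoDiv μ ν := by
  classical
  have hgi : ∀ i, MeasurableSet (g ⁻¹' {i}) := fun i => hg (measurableSet_singleton i)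
  let G : 𝔸 → Fin n × Bool := fun a => (g a, decide (a ∈ B))
  have hGt : ∀ i, G ⁻¹' {(i, true)} = g ⁻¹' {i} ∩ B := fun i => by ext a; simp [G]
  have hGf : ∀ i, G ⁻¹' {(i, false)} = g ⁻¹' {i} \ B := fun i => by ext a; simp [G]
  have hle := sum_divTerm_le_infoDiv μ ν G (by
    rintro ⟨i, _ | _⟩
    · rw [hGf]; exact (hgi i).diff hB
    · rw [hGt]; exact (hgi i).inter hB)
  rw [Fintype.sum_prod_type] at hle
  simp only [Fintype.sum_bool, hGt, hGf] at hle
  refine le_trans ?_ hle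
  have hBsum : ∀ ρ : Measure 𝔸, ρ B = ∑ i, ρ (g ⁻¹' {i} ∩ B) := by
    intro ρ
    have := measure_preimage_eq_sum (ρ.restrict B) g hgi (fun _ => ()) ()
    have h2 : (fun _ : Fin n => ()) ∘ g ⁻¹' {()} = Set.univ := by ext; simp
    rw [h2, Measure.restrict_apply_univ] at this
    simpa [Measure.restrict_apply (hgi _)] using this
  rw [Finset.sum_add_distrib, add_comm]
  refine add_le_add ?_ (Finset.sum_le_sum fun i _ => ?_)
  · rw [hBsum μ, hBsum ν]
    exact divTerm_sum_le _ _ _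
  -- An infinite cell contributes zero, so removing `B` from it loses nothing; a finite cell does
  -- not meet `B`.
  · by_cases hi : ν (g ⁻¹' {i}) = ∞
    · rw [hi, (measure_eq_top_iff_of_infoDiv_ne_top h (hgi i)).2 hi, divTerm_top_top]
      exact zero_le
    · rw [(hBg i hi).sdiff_eq_left]

/-- If the divergence is finite, the two measures agree outside a countable union of sets of
finite measure. -/
lemma exists_partition_of_infoDiv_ne_top {μ ν : Measure 𝔸} (h : infoDiv μ ν ≠ ∞) :
    ∃ T : ℕ → Set 𝔸, (∀ k, MeasurableSet (T k)) ∧ (∀ k, μ (T k) ≠ ∞) ∧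
      μ.restrict (⋃ k, T k)ᶜ = ν.restrict (⋃ k, T k)ᶜ := by
  classical
  let d : FinPartition 𝔸 → ℝ≥0∞ := fun G =>
    ∑ i, divTerm (μ (G.2.1 ⁻¹' {i})) (ν (G.2.1 ⁻¹' {i}))
  have hne : (Set.range d).Nonempty := ⟨_, ⟨1, fun _ => 0, measurable_const⟩, rfl⟩
  obtain ⟨v, -, hv, hvd⟩ := exists_seq_tendsto_sSup hne (OrderTop.bddAbove _)
  choose G hG using hvd
  have hsup : sSup (Set.range d) = infoDiv μ ν := (infoDiv_eq_iSup_finPartition μ ν).symm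
  rw [hsup] at hv
  -- The cells of finite `ν`-measure in a maximizing sequence of partitions. `none` keeps the index
  -- type nonempty, as its enumeration by `ℕ` requires.
  let c : Option (Σ k : ℕ, Fin (G k).1) → Set 𝔸 := fun o =>
    match o with
    | none => ∅
    | some p => if ν ((G p.1).2.1 ⁻¹' {p.2}) = ∞ then ∅ else (G p.1).2.1 ⁻¹' {p.2}
  have hGm : ∀ k i, MeasurableSet ((G k).2.1 ⁻¹' {i}) := fun k i =>
    (G k).2.2 (measurableSet_singleton i)
  have hcm : ∀ o, MeasurableSet (c o) := by
    rintro (_ | p)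
    · exact MeasurableSet.empty
    · simp only [c]
      split_ifs
      · exact MeasurableSet.empty
      · exact hGm _ _
  have hcν : ∀ o, ν (c o) ≠ ∞ := by
    rintro (_ | p)
    · simp [c]
    · simp only [c]
      split_ifs with hp
      · simp
      · exact hp
  obtain ⟨e, he⟩ := exists_surjective_nat (Option (Σ k : ℕ, Fin (G k).1))
  have hUm : MeasurableSet (⋃ k, c (e k)) := MeasurableSet.iUnion fun k => hcm _
  refine ⟨fun k => c (e k), fun k => hcm _, fun k => ?_, ?_⟩
  · rw [Ne, measure_eq_top_iff_of_infoDiv_ne_top h (hcm _)]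
    exact hcν _
  · ext A hA
    rw [Measure.restrict_apply hA, Measure.restrict_apply hA]
    set B := A ∩ (⋃ k, c (e k))ᶜ with hBdef
    have hB : MeasurableSet B := hA.inter hUm.compl
    -- `B` avoids every finite cell, so its divergence adds to each `v k`. As `v k` tends to the
    -- finite supremum, that extra term must vanish.
    have hkey : ∀ k, v k + divTerm (μ B) (ν B) ≤ infoDiv μ ν := by
      intro k
      rw [← hG k]
      refine sum_divTerm_add_divTerm_le_infoDiv h (G k).2.2 hB fun i hi => ?_
      obtain ⟨j, hj⟩ := he (some ⟨k, i⟩)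
      have hcj : c (e j) = (G k).2.1 ⁻¹' {i} := by
        rw [hj]; exact if_neg hi
      rw [← hcj]
      exact Set.disjoint_left.2 fun a ha haB => haB.2 (Set.mem_iUnion.2 ⟨j, ha⟩)
    have hlim := le_of_tendsto' (hv.add_const (divTerm (μ B) (ν B))) hkey
    refine eq_of_divTerm_eq_zero ?_
    have hlim' : infoDiv μ ν + divTerm (μ B) (ν B) ≤ infoDiv μ ν + 0 := by rwa [add_zero]
    exact le_zero_iff.1 ((ENNReal.add_le_add_iff_left h).1 hlim')

/-- A measure at finite divergence from the expectation measure of a Poisson process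
is itself the expectation measure of a Poisson process. -/
lemma exists_isPoissonProcess_of_infoDiv_ne_top {Q : Measure (EmpiricalMeasure 𝔸)}
    {μ ν : Measure 𝔸} (hQ : IsPoissonProcess Q ν) (h : infoDiv μ ν ≠ ∞) :
    ∃ R, IsPoissonProcess R μ := by
  have := hQ.isProbabilityMeasure
  obtain ⟨T, hT, hμT, hres⟩ := exists_partition_of_infoDiv_ne_top h
  have hUm : MeasurableSet (⋃ k, T k) := MeasurableSet.iUnion hT
  -- Index `0` carries the part shared with `ν`, the later indices the disjoint pieces of finite
  -- measure.
  let m : ℕ → Measure 𝔸 := fun k =>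
    match k with
    | 0 => μ.restrict (⋃ k, T k)ᶜ
    | k + 1 => μ.restrict (disjointed T k)
  have hsum : Measure.sum m = μ := by
    ext A hA
    rw [Measure.sum_apply _ hA, tsum_eq_zero_add' ENNReal.summable]
    have h1 : ∑' k, m (k + 1) A = μ.restrict (⋃ k, T k) A := by
      rw [← iUnion_disjointed, Measure.restrict_iUnion (disjoint_disjointed T)
        (fun k => MeasurableSet.disjointed hT k), Measure.sum_apply _ hA]
    rw [h1]
    simp only [m]
    rw [add_comm, ← Measure.add_apply, Measure.restrict_add_restrict_compl hUm]
  obtain ⟨R, hR, hRL⟩ := exists_hasPoissonLaplace_sum m (by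
    rintro (_ | k)
    · simp only [m, hres]
      exact exists_hasPoissonLaplace_restrict hQ.hasPoissonLaplace hUm.compl
    · have : IsFiniteMeasure (μ.restrict (disjointed T k)) :=
        isFiniteMeasure_restrict.2
          (ne_top_of_le_ne_top (hμT k) (measure_mono (disjointed_subset T k)))
      exact exists_hasPoissonLaplace_of_isFiniteMeasure _)
  rw [hsum] at hRL
  exact ⟨R, hRL.isPoissonProcess⟩

lemma lintegral_extPoisson (m : ℝ≥0∞) : ∫⁻ x, x ∂(extPoisson m) = m := by
  unfold extPoisson
  split_ifs with hm
  · rw [lintegral_dirac, hm]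
  · rw [lintegral_map (f := fun x => x) measurable_id (measurable_of_countable _), lintegral_countable',
      tsum_eq_zero_add' ENNReal.summable]
    have h : ∀ k : ℕ, ((k + 1 : ℕ) : ℝ≥0∞) * poissonMeasure m.toNNReal {k + 1}
        = m * (ENNReal.ofReal (Real.exp (-m.toReal) / k.factorial) * m ^ k) := by
      intro k
      have hpow : ∀ j : ℕ, m ^ j = ENNReal.ofReal (m.toReal ^ j) := fun j => by
        rw [ENNReal.ofReal_pow ENNReal.toReal_nonneg, ENNReal.ofReal_toReal hm]
      rw [mul_left_comm, ← pow_succ', hpow, poissonMeasure_singleton,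
        ← ENNReal.ofReal_natCast (k + 1), ← ENNReal.ofReal_mul (by positivity),
        ← ENNReal.ofReal_mul (by positivity), ENNReal.coe_toNNReal_eq_toReal]
      congr 1
      rw [Nat.factorial_succ]
      push_cast
      field_simp
    simp only [h]
    rw [ENNReal.tsum_mul_left, tsum_mul_pow_div_factorial m hm]
    simp

lemma IsPoissonProcess.expectationMeasure_eq {R : Measure (EmpiricalMeasure 𝔸)} {μ : Measure 𝔸}
    (hR : IsPoissonProcess R μ) : expectationMeasure R = μ := by
  ext A hA
  rw [expectationMeasure_apply R hA, ← lintegral_extPoisson (μ A), ← hR.map_eval A hA,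
    lintegral_map (f := fun x => x) measurable_id (measurable_eval hA)]

/-- Each `μ ∈ C` at finite divergence yields the competitor `Po(μ)`; in the Pythagorean identity for
it the first term is zero, so its divergence equals that of `μ`. -/
lemma infoDivSet_pointProcessesOver_le {Q : Measure (EmpiricalMeasure 𝔸)} {ν : Measure 𝔸}
    (hQ : IsPoissonProcess Q ν) (C : Set (Measure 𝔸)) :
    infoDivSet (pointProcessesOver C) Q ≤ infoDivSet C ν := by
  refine le_iInf₂ fun μ hμ => ?_
  rcases eq_or_ne (infoDiv μ ν) ∞ with h | h
  · rw [h]; exact le_top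
  obtain ⟨R, hR⟩ := exists_isPoissonProcess_of_infoDiv_ne_top hQ h
  have := hR.isProbabilityMeasure
  have he := hR.expectationMeasure_eq
  have hdiv : infoDiv R Q = infoDiv μ ν := by
    rw [infoDiv_eq_add_of_isPoissonProcess hQ (he.symm ▸ hR), infoDiv_self, zero_add, he]
  exact hdiv ▸ iInf₂_le R ⟨this, he.symm ▸ hμ⟩

end Projection

theorem mainTheorem7 {𝔸 : Type*} [MeasurableSpace 𝔸]
    (C : Set (Measure 𝔸)) (hC : Convex ℝ≥0 C)
    (ν νs : Measure 𝔸) (hproj : IsInfoProjection C ν νs)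
    (Q Qs : Measure (EmpiricalMeasure 𝔸))
    (hQ : IsPoissonProcess Q ν) (hQs : IsPoissonProcess Qs νs) :
    IsInfoProjection (pointProcessesOver C) Q Qs := by
  rintro P ⟨hP, hPC⟩
  -- Finiteness of this divergence is what provides the Poisson process `R` over the expectation
  -- measure of `P`.
  rcases eq_or_ne (infoDiv P Q) ∞ with htop | htop
  · rw [htop]; exact le_top
  have hfin : infoDiv (expectationMeasure P) ν ≠ ∞ :=
    ne_top_of_le_ne_top htop (infoDiv_expectationMeasure_le hQ)
  obtain ⟨R, hR⟩ := exists_isPoissonProcess_of_infoDiv_ne_top hQ hfin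
  calc infoDiv P Qs + infoDivSet (pointProcessesOver C) Q
      ≤ infoDiv P R + infoDiv (expectationMeasure P) νs + infoDivSet C ν := by
        rw [infoDiv_eq_add_of_isPoissonProcess hQs hR]
        gcongr
        exact infoDivSet_pointProcessesOver_le hQ C
    _ ≤ infoDiv P R + infoDiv (expectationMeasure P) ν := by
        rw [add_assoc]
        gcongr
        exact hproj _ hPC
    _ = infoDiv P Q := (infoDiv_eq_add_of_isPoissonProcess hQ hR).symm
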